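/- Let $\nu\in(0,1)$, $\beta>0$, and let $\lambda_1,\lambda_2,\dots\ge 0$ be pairwise distinct. A fractional nonlinear birth process with these data is an integer-valued process $\mathfrak N^\nu(t)$, $t\ge0$, with $\mathfrak N^\nu(0)=1$, whose paths are right-continuous and increase by unit jumps, finitely many in finite time (no explosion), and whose state probabilities $p_n(t)=\mathbb P(\mathfrak N^\nu(t)=n)$ are locally absolutely continuous and satisfy, for $n\ge1$ and $t>0$, $$\frac1{\Gamma(1-\nu)}\int_0^t\frac{p_n'(s)}{(t-s)^{\nu}}\,ds=-\lambda_np_n(t)+\lambda_{n-1}p_{n-1}(t),\qquad p_0=0 .$$ Consider the following generalized Yule model. There is one initial webpage at time $0$; the number of webpages is a Yule process of rate $\beta$ (when there are $k$ webpages, the next one appears after an independent exponential time of rate $k\beta$). The number of in-links of each webpage, as a function of the time elapsed since its creation, is a copy of $\mathfrak N^\nu$; these copies are independent of one another and of the webpage process. For $t>0$, given that at least one webpage has been created during $(0,t]$, let ${}_tN^\nu$ be the number of in-links at time $t$ of a webpage chosen uniformly at random among the webpages created during $(0,t]$. Write $\gamma(a,x)=\int_0^x s^{a-1}e^{-s}\,ds$;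 empty products equal $1$. **Theorem.** For every $t>0$, as an identity in $[0,\infty]$, $$\mathbb E\,{}_tN^\nu=1+\sum_{k=1}^\infty\Bigl[1-\frac1{1-e^{-\beta t}}\sum_{m=1}^k\Bigl(\prod_{\substack{l=1\\ l\ne m}}^k\frac{\lambda_l}{\lambda_l-\lambda_m}\Bigr)\sum_{r=0}^\infty\frac{\gamma(\nu r+1,\beta t)}{\Gamma(\nu r+1)}\Bigl(-\frac{\lambda_m}{\beta^\nu}\Bigr)^r\Bigr],$$ where the series over $r$ converge absolutely and all brackets are nonnegative. Moreover, as $t\to\infty$, ${}_tN^\nu$ converges in distribution to a random variable $N^\nu$ with values in the positive integers, and $$\lim_{t\to\infty}\mathbb E\,{}_tN^\nu=\mathbb E\,N^\nu=1+\sum_{k=1}^\infty\Bigl[1-\sum_{m=1}^k\Bigl(\prod_{\substack{l=1\\ l\ne m}}^k\frac{\lambda_l}{\lambda_l-\lambda_m}\Bigr)\frac{\beta^\nu}{\beta^\nu+\lambda_m}\Bigr]$$ in $[0,\infty]$, again with nonnegative brackets. -/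

import Mathlib

open MeasureTheory ProbabilityTheory Filter Topology
open scoped NNReal ENNReal

namespace NonlinearYule

/-- The Caputo derivative (with base point `0`) of order `ν ∈ (0,1)` of `f` at `t`,
`(1 / Γ(1 - ν)) ∫₀ᵗ f'(s) (t - s)^(-ν) ds`. -/
noncomputable def caputoDeriv (ν : ℝ) (f : ℝ → ℝ) (t : ℝ) : ℝ :=
  1 / Real.Gamma (1 - ν) * ∫ s in (0 : ℝ)..t, deriv f s / (t - s) ^ ν

/-- The state probability `p_n(t) = P(X_t = n)`, as a function of real time `t ≥ 0`. -/
noncomputable def stateProb {Ω : Type*} [MeasurableSpace Ω] (P : Measure Ω)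
    (X : ℝ≥0 → Ω → ℕ) (n : ℕ) (t : ℝ) : ℝ :=
  P.real {ω | X t.toNNReal ω = n}

/-- `X` is a fractional nonlinear birth process with parameter of fractionality `ν` and rates
`rate 1, rate 2, …` (the value `rate 0` is irrelevant), started from one individual: its paths are
right-continuous step functions that start at `1` and move by unit jumps, finitely many in finite
time, and its state probabilities are locally absolutely continuous and solve
`d^ν p_n / dt^ν = - λ_n p_n + λ_{n-1} p_{n-1}`, `n ≥ 1`, with the Caputo derivative
(`p_0 = 0` and `p_n(0) = δ_{n,1}` follow from `start` and `mono`). -/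
structure IsFractionalBirthProcess {Ω : Type*} [MeasurableSpace Ω] (P : Measure Ω)
    (ν : ℝ) (rate : ℕ → ℝ) (X : ℝ≥0 → Ω → ℕ) : Prop where
  measurable : ∀ t, Measurable (X t)
  start : ∀ ω, X 0 ω = 1
  mono : ∀ ω, Monotone (fun t => X t ω)
  rightCont : ∀ ω t, ContinuousWithinAt (fun s => X s ω) (Set.Ici t) t
  unitJumps : ∀ ω t n, 1 ≤ n → n ≤ X t ω → ∃ s ≤ t, X s ω = n
  absCont : ∀ n, 1 ≤ n → ∀ b : ℝ, 0 < b → AbsolutelyContinuousOnInterval (stateProb P X n) 0 b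
  integrable : ∀ n, 1 ≤ n → ∀ t : ℝ, 0 < t →
    IntervalIntegrable (fun s => deriv (stateProb P X n) s / (t - s) ^ ν) volume 0 t
  caputo_eq : ∀ n, 1 ≤ n → ∀ t : ℝ, 0 < t →
    caputoDeriv ν (stateProb P X n) t =
      -(rate n) * stateProb P X n t + rate (n - 1) * stateProb P X (n - 1) t

/-- The generalized nonlinear Yule model. Webpages are numbered `0, 1, 2, …` in the order of their
creation. `W i` is the time between the creation of page `i` and that of page `i + 1`; while there
are `i + 1` pages, new ones appear at total rate `(i + 1) β` (Yule process of rate `β`).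
`X i` is the in-link process of page `i`, as a function of the age of that page. `U` is a uniform
variable on `[0,1]` that serves to draw a page at random. -/
structure IsModel {Ω : Type*} [MeasurableSpace Ω] (P : Measure Ω) (ν β : ℝ) (rate : ℕ → ℝ)
    (W : ℕ → Ω → ℝ) (X : ℕ → ℝ≥0 → Ω → ℕ) (U : Ω → ℝ) : Prop where
  measurable_wait : ∀ i, Measurable (W i)
  law_wait : ∀ i, HasLaw (W i) (expMeasure (((i : ℝ) + 1) * β)) P
  indep_wait : iIndepFun W P
  birth : ∀ i, IsFractionalBirthProcess P ν rate (X i)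
  indep_birth : iIndepFun (fun i ω s => X i s ω) P
  indep_wait_birth : IndepFun (fun ω i => W i ω) (fun ω i s => X i s ω) P
  measurable_draw : Measurable U
  law_draw : HasLaw U (volume.restrict (Set.Icc (0 : ℝ) 1)) P
  indep_draw : IndepFun U (fun ω => ((fun i => W i ω), (fun i s => X i s ω))) P

/-- Creation time of page `i`; page `0` is the initial page, present at time `0`. -/
noncomputable def creationTime {Ω : Type*} (W : ℕ → Ω → ℝ) (i : ℕ) (ω : Ω) : ℝ :=
  ∑ j ∈ Finset.range i, W j ω

/-- The number of new pages at time `t`: those created during `(0, t]`. -/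
noncomputable def newPageCount {Ω : Type*} (W : ℕ → Ω → ℝ) (t : ℝ) (ω : Ω) : ℕ :=
  Set.ncard {i : ℕ | 1 ≤ i ∧ creationTime W i ω ≤ t}

/-- The index of a page drawn uniformly among the new pages `1, …, newPageCount W t ω`. -/
noncomputable def drawnPage {Ω : Type*} (W : ℕ → Ω → ℝ) (U : Ω → ℝ) (t : ℝ) (ω : Ω) : ℕ :=
  1 + ⌊U ω * (newPageCount W t ω : ℝ)⌋₊

/-- The number of in-links, at time `t`, of the page drawn at time `t`. -/
noncomputable def drawnInLinks {Ω : Type*} (W : ℕ → Ω → ℝ) (X : ℕ → ℝ≥0 → Ω → ℕ) (U : Ω → ℝ)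
    (t : ℝ) (ω : Ω) : ℕ :=
  X (drawnPage W U t ω) (t - creationTime W (drawnPage W U t ω) ω).toNNReal ω

/-- The probability given that there is a new page to draw at time `t`. -/
noncomputable def drawMeasure {Ω : Type*} [MeasurableSpace Ω] (P : Measure Ω) (W : ℕ → Ω → ℝ)
    (t : ℝ) : Measure Ω :=
  P[|{ω | 1 ≤ newPageCount W t ω}]

/-- The mean number of in-links of the page drawn at time `t`, a value in `[0, ∞]`. -/
noncomputable def meanInLinks {Ω : Type*} [MeasurableSpace Ω] (P : Measure Ω) (W : ℕ → Ω → ℝ)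
    (X : ℕ → ℝ≥0 → Ω → ℕ) (U : Ω → ℝ) (t : ℝ) : ℝ≥0∞ :=
  ∫⁻ ω, (drawnInLinks W X U t ω : ℝ≥0∞) ∂(drawMeasure P W t)

/-- The lower incomplete Gamma function `γ(a, x) = ∫₀ˣ s^(a-1) e^(-s) ds`. -/
noncomputable def lowerGamma (a x : ℝ) : ℝ :=
  ∫ s in (0 : ℝ)..x, s ^ (a - 1) * Real.exp (-s)

/-- The `r`-th term of the incomplete Gamma series,
`γ(νr+1, βt) / Γ(νr+1) * (-x / β^ν)^r`. -/
noncomputable def seriesTerm (ν β t x : ℝ) (r : ℕ) : ℝ :=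
  lowerGamma (ν * r + 1) (β * t) / Real.Gamma (ν * r + 1) * (-x / β ^ ν) ^ r

/-- The coefficient `∏_{l ≤ k, l ≠ m} λ_l / (λ_l - λ_m)`. -/
noncomputable def coeff (rate : ℕ → ℝ) (k m : ℕ) : ℝ :=
  ∏ l ∈ (Finset.Icc 1 k).erase m, rate l / (rate l - rate m)

/-- The `k`-th term of the series for the mean at time `t`. -/
noncomputable def meanTerm (ν β : ℝ) (rate : ℕ → ℝ) (t : ℝ) (k : ℕ) : ℝ :=
  1 - 1 / (1 - Real.exp (-(β * t))) *
    ∑ m ∈ Finset.Icc 1 k, coeff rate k m * ∑' r : ℕ, seriesTerm ν β t (rate m) r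

/-- The `k`-th term of the series for the limiting mean. -/
noncomputable def limitTerm (ν β : ℝ) (rate : ℕ → ℝ) (k : ℕ) : ℝ :=
  1 - ∑ m ∈ Finset.Icc 1 k, coeff rate k m * (β ^ ν / (β ^ ν + rate m))

end NonlinearYule

/-! The argument separates the age of the drawn page from the state of an in-link process at a given
age.

Age. If `T_i` is the creation time of page `i`, the expectation of `g(T_1) + … + g(T_{n+1})` on the
event of exactly `n + 1` new pages is `(n+1) (1 - e^(-βt))^n e^(-2βt) ∫₀ᵗ g(u) β e^(βu) du`
(`lintegral_creationSum_between`). A uniform draw divides by `n + 1`, so `n` survives only in a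
geometric factor; summing it shows that the age of the drawn page has density `β e^(-βs) / (1 -
e^(-βt))` on `(0, t]` (`tsum_lintegral_creationSum`). The age is a function of `U` and `W`, hence
independent of the in-link processes, and `setLIntegral_independent_time` allows the state to be
taken at that random age. The tail `P(ₜN > k)` is then the integral of `1 - F_k(s)` against this
density, with `F_k(s) = P(𝔑(s) ≤ k)`, and the mean is the sum of the tails.

Birth process. Adding the equations for `p_1, …, p_k` telescopes to `D^ν F_k = -λ_k p_k`. Since
`F_k` is antitone, everything is a convolution of nonnegative functions; fractional integration
gives `1 - F_k = λ_k I^ν (F_k - F_{k-1})` (`lconvolution_stateProb`). This is an Abel equation for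
`F_k` with a unique bounded solution, so `F_k(t) = ∑_m coeff k m · E_ν(-λ_m t^ν)`
(`cdfProb_eq_sum`). Integrating the Mittag-Leffler series termwise over `(0, t]` produces the
incomplete Gamma functions.

Limit. Termwise integration over `(0, ∞)` would produce the geometric series of ratio `-λ_m / β^ν`,
which need not converge. Instead the Laplace transform at `β` is applied to the integral equation.
The tails at an exponential time satisfy `(β^ν + λ_k) L_k = λ_k L_{k-1}` with `L_0 = 1`, the
recursion of `limitTerm`. All integrands are nonnegative, so the limit in `t` is monotone
convergence of the integral together with `1 - e^(-βt) → 1`, and infinite means are covered. -/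

namespace NonlinearYule

/-! ### Riemann-Liouville kernels, their convolutions and Laplace transforms -/

/-- The kernel `x ^ (a - 1) / Γ(a)` of the Riemann-Liouville integral of order `a`, extended by
zero to `x ≤ 0`. -/
noncomputable def powKernel (a x : ℝ) : ℝ :=
  if 0 < x then x ^ (a - 1) / Real.Gamma a else 0

theorem powKernel_of_pos {a x : ℝ} (hx : 0 < x) : powKernel a x = x ^ (a - 1) / Real.Gamma a :=
  if_pos hx

theorem powKernel_of_nonpos {a x : ℝ} (hx : x ≤ 0) : powKernel a x = 0 :=
  if_neg hx.not_gt

theorem powKernel_one {x : ℝ} (hx : 0 < x) : powKernel 1 x = 1 := by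
  simp [powKernel_of_pos hx]

theorem powKernel_nonneg {a : ℝ} (ha : 0 < a) (x : ℝ) : 0 ≤ powKernel a x := by
  unfold powKernel
  have := Real.Gamma_pos_of_pos ha
  split_ifs <;> positivity

@[fun_prop]
theorem measurable_powKernel (a : ℝ) : Measurable (powKernel a) := by
  unfold powKernel
  exact Measurable.ite measurableSet_Ioi (by fun_prop) measurable_const

/-- This is the complex Beta integral at real exponents: on `[0, t]` both bases are nonnegative, so
the complex powers are casts of real ones. -/
theorem integral_rpow_mul_rpow {a b t : ℝ} (ha : 0 < a) (hb : 0 < b) (ht : 0 < t) :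
    ∫ u in (0 : ℝ)..t, u ^ (a - 1) * (t - u) ^ (b - 1) =
      t ^ (a + b - 1) * (Real.Gamma a * Real.Gamma b / Real.Gamma (a + b)) := by
  have h := Complex.betaIntegral_scaled (a : ℂ) (b : ℂ) ht
  rw [Complex.betaIntegral_eq_Gamma_mul_div _ _ (by simpa) (by simpa)] at h
  have h1 : ∫ x in (0 : ℝ)..t, (x : ℂ) ^ ((a : ℂ) - 1) * ((t : ℂ) - x) ^ ((b : ℂ) - 1) =
      ∫ x in (0 : ℝ)..t, ((x ^ (a - 1) * (t - x) ^ (b - 1) : ℝ) : ℂ) := by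
    refine intervalIntegral.integral_congr fun x hx => ?_
    rw [Set.uIcc_of_le ht.le] at hx
    push_cast
    rw [Complex.ofReal_cpow hx.1, Complex.ofReal_cpow (sub_nonneg.2 hx.2)]
    push_cast
    rfl
  rw [h1, intervalIntegral.integral_ofReal] at h
  have h2 : ((t : ℂ) ^ ((a : ℂ) + b - 1)) = ((t ^ (a + b - 1) : ℝ) : ℂ) := by
    rw [Complex.ofReal_cpow ht.le]; push_cast; rfl
  rw [h2, ← Complex.ofReal_add, Complex.Gamma_ofReal, Complex.Gamma_ofReal,
    Complex.Gamma_ofReal] at h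
  exact_mod_cast h

theorem integral_powKernel_mul {a b t : ℝ} (ha : 0 < a) (hb : 0 < b) (ht : 0 < t) :
    ∫ u in (0 : ℝ)..t, powKernel a (t - u) * powKernel b u = powKernel (a + b) t := by
  have ga := (Real.Gamma_pos_of_pos ha).ne'
  have gb := (Real.Gamma_pos_of_pos hb).ne'
  have h1 : ∫ u in (0 : ℝ)..t, powKernel a (t - u) * powKernel b u =
      ∫ u in (0 : ℝ)..t, (u ^ (b - 1) * (t - u) ^ (a - 1)) *
        (1 / (Real.Gamma a * Real.Gamma b)) := by
    refine intervalIntegral.integral_congr_ae ?_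
    have : ∀ᵐ u : ℝ, u ≠ t := by simp [ae_iff, measure_singleton]
    filter_upwards [this] with u hne hu
    rw [Set.uIoc_of_le ht.le] at hu
    rw [powKernel_of_pos hu.1, powKernel_of_pos (sub_pos.2 (lt_of_le_of_ne hu.2 hne))]
    field_simp
  rw [h1, intervalIntegral.integral_mul_const, integral_rpow_mul_rpow hb ha ht,
    powKernel_of_pos ht, add_comm b a]
  field_simp

theorem intervalIntegrable_powKernel_mul {a b t : ℝ} (ha : 0 < a) (hb : 0 < b) (ht : 0 < t) :
    IntervalIntegrable (fun u => powKernel a (t - u) * powKernel b u) volume 0 t := by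
  -- A non-integrable function has integral `0` by convention, so the nonzero Beta value already
  -- yields integrability.
  refine intervalIntegral.intervalIntegrable_of_integral_ne_zero ?_
  rw [integral_powKernel_mul ha hb ht, powKernel_of_pos ht]
  have := Real.Gamma_pos_of_pos (add_pos ha hb)
  positivity

theorem intervalIntegrable_powKernel {a t : ℝ} (ha : 0 < a) (ht : 0 < t) :
    IntervalIntegrable (fun u => powKernel a (t - u)) volume 0 t := by
  refine (intervalIntegrable_powKernel_mul ha one_pos ht).congr fun u hu => ?_
  rw [Set.uIoc_of_le ht.le] at hu
  simp [powKernel_one hu.1]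

/-- The convolution of two functions that vanish on the nonpositive half-line. -/
theorem lconvolution_eq_setLIntegral {f g : ℝ → ℝ≥0∞} (hf : ∀ x ≤ 0, f x = 0)
    (hg : ∀ x ≤ 0, g x = 0) (t : ℝ) :
    lconvolution f g volume t = ∫⁻ u in Set.Ioc 0 t, f u * g (t - u) := by
  rw [lconvolution_def, ← lintegral_indicator measurableSet_Ioc]
  refine lintegral_congr fun u => ?_
  by_cases hu : u ∈ Set.Ioc 0 t
  · rw [Set.indicator_of_mem hu, neg_add_eq_sub]
  · rw [Set.indicator_of_notMem hu]
    rcases le_or_gt u 0 with h | h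
    · simp [hf u h]
    · have : t < u := by by_contra! h'; exact hu ⟨h, h'⟩
      rw [hg _ (by linarith), mul_zero]

theorem lconvolution_of_nonpos {f g : ℝ → ℝ≥0∞} (hf : ∀ x ≤ 0, f x = 0)
    (hg : ∀ x ≤ 0, g x = 0) {t : ℝ} (ht : t ≤ 0) : lconvolution f g volume t = 0 := by
  rw [lconvolution_eq_setLIntegral hf hg, Set.Ioc_eq_empty ht.not_gt]
  simp

/-- The semigroup law `I^a I^b = I^(a+b)` of fractional integration. With `[0, ∞]`-valued kernels,
later uses of associativity need measurability only. -/
theorem lconvolution_powKernel {a b : ℝ} (ha : 0 < a) (hb : 0 < b) :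
    lconvolution (fun x => ENNReal.ofReal (powKernel a x))
      (fun x => ENNReal.ofReal (powKernel b x)) volume =
        fun x => ENNReal.ofReal (powKernel (a + b) x) := by
  have h0 : ∀ c : ℝ, ∀ x ≤ 0, ENNReal.ofReal (powKernel c x) = 0 := fun c x hx => by
    simp [powKernel_of_nonpos hx]
  ext t
  rcases le_or_gt t 0 with ht | ht
  · rw [lconvolution_of_nonpos (h0 a) (h0 b) ht, h0 _ _ ht]
  · rw [lconvolution_eq_setLIntegral (h0 a) (h0 b), add_comm a b,
      ← integral_powKernel_mul hb ha ht, intervalIntegral.integral_of_le ht.le,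
      ofReal_integral_eq_lintegral_ofReal
        ((intervalIntegrable_iff_integrableOn_Ioc_of_le ht.le).1
          (intervalIntegrable_powKernel_mul hb ha ht))
        (ae_of_all _ fun u => mul_nonneg (powKernel_nonneg hb _) (powKernel_nonneg ha _))]
    refine lintegral_congr fun u => ?_
    rw [ENNReal.ofReal_mul (powKernel_nonneg hb _), mul_comm]

/-- The Laplace transform turns convolutions into products. -/
theorem lintegral_exp_mul_lconvolution {f g : ℝ → ℝ≥0∞} (hf : Measurable f) (hg : Measurable g)
    (z : ℝ) :
    ∫⁻ x, ENNReal.ofReal (Real.exp (-(z * x))) * lconvolution f g volume x =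
      (∫⁻ x, ENNReal.ofReal (Real.exp (-(z * x))) * f x) *
        ∫⁻ x, ENNReal.ofReal (Real.exp (-(z * x))) * g x := by
  simp_rw [lconvolution_def]
  have h1 : ∀ x, ENNReal.ofReal (Real.exp (-(z * x))) * ∫⁻ y, f y * g (-y + x) =
      ∫⁻ y, ENNReal.ofReal (Real.exp (-(z * x))) * (f y * g (-y + x)) := fun x => by
    rw [lintegral_const_mul _ (by fun_prop)]
  simp_rw [h1]
  rw [lintegral_lintegral_swap (by fun_prop), ← lintegral_mul_const _ (by fun_prop)]
  refine lintegral_congr fun y => ?_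
  rw [← lintegral_const_mul _ (by fun_prop),
    ← lintegral_add_left_eq_self
      (fun x => ENNReal.ofReal (Real.exp (-(z * x))) * (f y * g (-y + x))) y]
  refine lintegral_congr fun x => ?_
  rw [neg_add_cancel_left, show -(z * (y + x)) = -(z * y) + -(z * x) by ring, Real.exp_add,
    ENNReal.ofReal_mul (Real.exp_pos _).le]
  ring

theorem lintegral_exp_mul_powKernel {a z : ℝ} (ha : 0 < a) (hz : 0 < z) :
    ∫⁻ x, ENNReal.ofReal (Real.exp (-(z * x))) * ENNReal.ofReal (powKernel a x) =
      ENNReal.ofReal (1 / z ^ a) := by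
  have h := lintegral_gammaPDF_eq_one ha hz
  have hza : 0 < z ^ a := by positivity
  have h2 : ∀ᵐ x, ENNReal.ofReal (Real.exp (-(z * x))) * ENNReal.ofReal (powKernel a x) =
      ENNReal.ofReal (1 / z ^ a) * gammaPDF a z x := by
    have : ∀ᵐ u : ℝ, u ≠ 0 := by simp [ae_iff, measure_singleton]
    filter_upwards [this] with x hx0
    rcases lt_or_gt_of_ne hx0 with hx | hx
    · rw [gammaPDF_of_neg hx, powKernel_of_nonpos hx.le]; simp
    · rw [gammaPDF_of_nonneg hx.le, powKernel_of_pos hx, ← ENNReal.ofReal_mul (Real.exp_pos _).le,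
        ← ENNReal.ofReal_mul (by positivity)]
      congr 1
      field_simp
  rw [lintegral_congr_ae h2, lintegral_const_mul _ (by unfold gammaPDF; fun_prop), h, mul_one]

/-! ### Mittag-Leffler functions and the Abel integral equation -/

/-- The Mittag-Leffler type function `t ↦ E_ν(x t^ν) = ∑ x^r t^(νr) / Γ(νr+1)`, for `t > 0`. -/
noncomputable def mittagLeffler (ν x t : ℝ) : ℝ :=
  ∑' r : ℕ, x ^ r * powKernel (ν * r + 1) t

/-- Keep only the part `x > a` of the Gamma integral, where `x^s ≥ a^s`. As `a` is free, `Γ(νr + 1)`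
outgrows every geometric sequence in `r`. -/
theorem rpow_mul_exp_neg_le_Gamma {a s : ℝ} (ha : 0 < a) (hs : 0 ≤ s) :
    a ^ s * Real.exp (-a) ≤ Real.Gamma (s + 1) := by
  rw [Real.Gamma_eq_integral (by linarith), ← integral_exp_neg_Ioi a,
    ← integral_const_mul]
  have hint := Real.GammaIntegral_convergent (s := s + 1) (by linarith)
  calc ∫ x in Set.Ioi a, a ^ s * Real.exp (-x)
      ≤ ∫ x in Set.Ioi a, Real.exp (-x) * x ^ (s + 1 - 1) := by
        refine setIntegral_mono_on ((integrableOn_exp_neg_Ioi a).const_mul _)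
          (hint.mono_set (Set.Ioi_subset_Ioi ha.le)) measurableSet_Ioi fun x hx => ?_
        rw [add_sub_cancel_right, mul_comm]
        gcongr
        exact le_of_lt hx
    _ ≤ _ := by
        refine setIntegral_mono_set hint ?_ (Set.Ioi_subset_Ioi ha.le).eventuallyLE
        filter_upwards [ae_restrict_mem measurableSet_Ioi] with x hx
        have : (0 : ℝ) < x := hx
        simp only [Pi.zero_apply]
        positivity

theorem summable_pow_div_Gamma {ν : ℝ} (hν : 0 < ν) (x : ℝ) :
    Summable fun r : ℕ => x ^ r / Real.Gamma (ν * r + 1) := by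
  -- This choice makes `a^(νr) = (2|x| + 1)^r`, so the series is dominated by a geometric one of
  -- ratio `|x| / (2|x| + 1) < 1`.
  set a : ℝ := (2 * |x| + 1) ^ (1 / ν)
  have ha : 0 < a := by positivity
  have haν : a ^ ν = 2 * |x| + 1 := by
    rw [← Real.rpow_mul (by positivity), one_div_mul_cancel hν.ne', Real.rpow_one]
  have hq : |x| / (2 * |x| + 1) < 1 := by
    rw [div_lt_one (by positivity)]; linarith [abs_nonneg x]
  refine Summable.of_norm_bounded
    ((summable_geometric_of_lt_one (by positivity) hq).mul_left (Real.exp a)) fun r => ?_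
  have h := rpow_mul_exp_neg_le_Gamma ha (s := ν * r) (by positivity)
  rw [Real.rpow_mul ha.le, haν, Real.rpow_natCast] at h
  have hg : 0 < Real.Gamma (ν * r + 1) := Real.Gamma_pos_of_pos (by positivity)
  rw [norm_div, norm_pow, Real.norm_eq_abs, Real.norm_of_nonneg hg.le, div_pow, div_le_iff₀ hg]
  calc |x| ^ r = Real.exp a * (|x| ^ r / (2 * |x| + 1) ^ r) *
        ((2 * |x| + 1) ^ r * Real.exp (-a)) := by
          rw [Real.exp_neg]
          field_simp
    _ ≤ _ := by gcongr

theorem pow_mul_powKernel {ν t : ℝ} (ht : 0 < t) (x : ℝ) (r : ℕ) :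
    x ^ r * powKernel (ν * r + 1) t = (x * t ^ ν) ^ r / Real.Gamma (ν * r + 1) := by
  rw [powKernel_of_pos ht, add_sub_cancel_right, Real.rpow_mul ht.le, Real.rpow_natCast, mul_pow]
  ring

theorem summable_mittagLeffler {ν : ℝ} (hν : 0 < ν) (x t : ℝ) :
    Summable fun r : ℕ => x ^ r * powKernel (ν * r + 1) t := by
  rcases le_or_gt t 0 with ht | ht
  · simp only [powKernel_of_nonpos ht, mul_zero]
    exact summable_zero
  · simp_rw [pow_mul_powKernel ht]
    exact summable_pow_div_Gamma hν _

theorem measurable_mittagLeffler {ν : ℝ} (hν : 0 < ν) (x : ℝ) :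
    Measurable (mittagLeffler ν x) := by
  refine measurable_of_tendsto_metrizable
    (f := fun n t => ∑ r ∈ Finset.range n, x ^ r * powKernel (ν * r + 1) t) (fun n => ?_) ?_
  · exact Finset.measurable_fun_sum _ fun r _ => by fun_prop
  · exact tendsto_pi_nhds.2 fun t => (summable_mittagLeffler hν x t).hasSum.tendsto_sum_nat

theorem abs_mittagLeffler_le {ν : ℝ} (hν : 0 < ν) (x : ℝ) {t T : ℝ} (ht : 0 < t) (hT : t ≤ T) :
    |mittagLeffler ν x t| ≤ mittagLeffler ν |x| T := by
  rw [← Real.norm_eq_abs, mittagLeffler]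
  refine tsum_of_norm_bounded (summable_mittagLeffler hν |x| T).hasSum fun r => ?_
  have hg : 0 < Real.Gamma (ν * r + 1) := Real.Gamma_pos_of_pos (by positivity)
  rw [pow_mul_powKernel ht, pow_mul_powKernel (ht.trans_le hT), norm_div, norm_pow,
    Real.norm_of_nonneg hg.le, norm_mul, Real.norm_eq_abs, Real.norm_of_nonneg (by positivity)]
  gcongr

theorem intervalIntegrable_powKernel_mul_bounded {a t : ℝ} (ha : 0 < a) (ht : 0 < t)
    {f : ℝ → ℝ} (hf : Measurable f) {M : ℝ} (hM : ∀ u, 0 < u → u ≤ t → |f u| ≤ M) :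
    IntervalIntegrable (fun u => powKernel a (t - u) * f u) volume 0 t := by
  refine ((intervalIntegrable_powKernel ha ht).mul_const M).mono_fun (by fun_prop) ?_
  filter_upwards [ae_restrict_mem measurableSet_uIoc] with u hu
  rw [Set.uIoc_of_le ht.le] at hu
  rw [norm_mul, norm_mul]
  gcongr
  exact (hM u hu.1 hu.2).trans (le_abs_self M)

/-- Fractional integration of order `ν` turns the kernel of order `νr + 1` into that of order
`ν(r+1) + 1`, so it shifts the series by one index; the term `r = 0` is the constant `1`. -/
theorem mittagLeffler_eq {ν : ℝ} (hν : 0 < ν) (x : ℝ) {t : ℝ} (ht : 0 < t) :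
    mittagLeffler ν x t =
      1 + x * ∫ u in (0 : ℝ)..t, powKernel ν (t - u) * mittagLeffler ν x u := by
  have hF : ∀ y : ℝ, ∀ r : ℕ, ∫ u in Set.Ioc 0 t,
      powKernel ν (t - u) * (y ^ r * powKernel (ν * r + 1) u) =
        y ^ r * powKernel (ν * (r + 1 : ℕ) + 1) t := fun y r => by
    have := integral_powKernel_mul hν (b := ν * r + 1) (by positivity) ht
    rw [intervalIntegral.integral_of_le ht.le] at this
    simp_rw [mul_left_comm (powKernel ν _)]
    rw [integral_const_mul, this]
    congr 2
    push_cast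
    ring
  have hnorm : ∀ r : ℕ, ∫ u in Set.Ioc 0 t,
      ‖powKernel ν (t - u) * (x ^ r * powKernel (ν * r + 1) u)‖ =
        |x| ^ r * powKernel (ν * (r + 1 : ℕ) + 1) t := fun r => by
    rw [← hF]
    refine integral_congr_ae (ae_of_all _ fun u => ?_)
    simp only [norm_mul, norm_pow, Real.norm_eq_abs]
    rw [abs_of_nonneg (powKernel_nonneg hν _), abs_of_nonneg (powKernel_nonneg (by positivity) _)]
  -- The shifted series is the tail of the original one divided by `y`, whence the separate case `y
  -- = 0`.
  have hshift : ∀ y : ℝ, Summable fun r : ℕ => y ^ r * powKernel (ν * (r + 1 : ℕ) + 1) t :=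
    fun y => by
      rcases eq_or_ne y 0 with rfl | hy
      · refine summable_of_ne_finset_zero (s := {0}) fun r hr => ?_
        simp only [Finset.mem_singleton] at hr
        simp [hr]
      · have := ((summable_nat_add_iff 1).2 (summable_mittagLeffler hν y t)).mul_left y⁻¹
        refine this.congr fun r => ?_
        rw [pow_succ]
        field_simp
  have key := hasSum_integral_of_summable_integral_norm
    (F := fun (r : ℕ) u => powKernel ν (t - u) * (x ^ r * powKernel (ν * r + 1) u))
    (μ := volume.restrict (Set.Ioc 0 t)) (fun r => by
      have := intervalIntegrable_powKernel_mul hν (b := ν * r + 1) (by positivity) ht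
      have := ((intervalIntegrable_iff_integrableOn_Ioc_of_le ht.le).1 this).const_mul (x ^ r)
      simpa only [mul_left_comm (powKernel ν _)] using this)
    (by simp_rw [hnorm]; exact hshift |x|)
  simp_rw [hF, tsum_mul_left] at key
  rw [intervalIntegral.integral_of_le ht.le]
  change _ = 1 + x * ∫ u in Set.Ioc 0 t, powKernel ν (t - u) *
    ∑' r : ℕ, x ^ r * powKernel (ν * r + 1) u
  rw [← key.tsum_eq, ← tsum_mul_left, mittagLeffler,
    (summable_mittagLeffler hν x t).tsum_eq_zero_add]
  congr 1
  · simp [powKernel_one ht]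
  · refine tsum_congr fun r => ?_
    rw [pow_succ]
    ring

/-- Uniqueness of bounded solutions of the Abel equation. -/
theorem eq_zero_of_abel_equation {ν : ℝ} (hν : 0 < ν) {x T M : ℝ} {d : ℝ → ℝ}
    (hM : ∀ t, 0 < t → t ≤ T → |d t| ≤ M)
    (hd : ∀ t, 0 < t → t ≤ T → d t = x * ∫ u in (0 : ℝ)..t, powKernel ν (t - u) * d u)
    {t : ℝ} (ht : 0 < t) (htT : t ≤ T) : d t = 0 := by
  -- Picard iteration: each use of the equation gains a factor `|x|` and raises the kernel order by
  -- `ν`. The bounds are terms of a convergent Mittag-Leffler series, hence tend to `0`.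
  have hbound : ∀ n : ℕ, ∀ s, 0 < s → s ≤ T → |d s| ≤ M * (|x| ^ n * powKernel (ν * n + 1) s) := by
    intro n
    induction n with
    | zero => intro s hs hsT; simpa [powKernel_one hs] using hM s hs hsT
    | succ n ih =>
      intro s hs hsT
      have hb := integral_powKernel_mul hν (b := ν * n + 1) (by positivity) hs
      have hi := intervalIntegrable_powKernel_mul hν (b := ν * n + 1) (by positivity) hs
      have h := intervalIntegral.norm_integral_le_of_norm_le (a := 0) (b := s) hs.le
        (f := fun u => powKernel ν (s - u) * d u)
        (g := fun u => M * |x| ^ n * (powKernel ν (s - u) * powKernel (ν * n + 1) u))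
        (ae_of_all _ fun u hu => by
          rw [norm_mul, Real.norm_of_nonneg (powKernel_nonneg hν _), Real.norm_eq_abs]
          calc powKernel ν (s - u) * |d u|
              ≤ powKernel ν (s - u) * (M * (|x| ^ n * powKernel (ν * n + 1) u)) := by
                gcongr
                · exact powKernel_nonneg hν _
                · exact ih u hu.1 (hu.2.trans hsT)
            _ = _ := by ring) (hi.const_mul _)
      rw [intervalIntegral.integral_const_mul, hb, Real.norm_eq_abs] at h
      rw [hd s hs hsT, abs_mul]
      calc _ ≤ |x| * (M * |x| ^ n * powKernel (ν + (ν * n + 1)) s) := by gcongr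
        _ = _ := by
          rw [show ν + (ν * n + 1) = ν * (n + 1 : ℕ) + 1 by push_cast; ring]
          ring
  have hlim : Tendsto (fun n : ℕ => M * (|x| ^ n * powKernel (ν * n + 1) t)) atTop (𝓝 0) := by
    simpa using (summable_mittagLeffler hν |x| t).tendsto_atTop_zero.const_mul M
  exact abs_nonpos_iff.1 (ge_of_tendsto' hlim fun n => hbound n t ht htT)

/-! ### Distribution functions of the birth process and their integral equations -/

/-- The distribution function of the state at time `t`, `P(X_t ≤ k)`. -/
noncomputable def cdfProb {Ω : Type*} [MeasurableSpace Ω] (P : Measure Ω)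
    (X : ℝ≥0 → Ω → ℕ) (k : ℕ) (t : ℝ) : ℝ :=
  P.real {ω | X t.toNNReal ω ≤ k}

section StateProbabilities

variable {Ω : Type*} [MeasurableSpace Ω] {P : Measure Ω}
  {ν : ℝ} {rate : ℕ → ℝ} {X : ℝ≥0 → Ω → ℕ}

theorem IsFractionalBirthProcess.one_le (hX : IsFractionalBirthProcess P ν rate X) (t : ℝ≥0)
    (ω : Ω) : 1 ≤ X t ω :=
  (hX.start ω).symm.le.trans (hX.mono ω (zero_le : 0 ≤ t))

theorem IsFractionalBirthProcess.cdfProb_zero (hX : IsFractionalBirthProcess P ν rate X) :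
    cdfProb P X 0 = 0 := by
  ext t
  have : {ω | X t.toNNReal ω ≤ 0} = ∅ :=
    Set.eq_empty_of_forall_notMem fun ω hω => absurd ((hX.one_le t.toNNReal ω).trans hω) (by simp)
  rw [cdfProb, this, measureReal_empty, Pi.zero_apply]

theorem IsFractionalBirthProcess.stateProb_zero (hX : IsFractionalBirthProcess P ν rate X)
    (t : ℝ) : stateProb P X 0 t = 0 := by
  have := congrFun hX.cdfProb_zero t
  simpa [cdfProb, stateProb] using this

theorem cdfProb_nonneg (k : ℕ) (t : ℝ) : 0 ≤ cdfProb P X k t := measureReal_nonneg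

theorem stateProb_nonneg (k : ℕ) (t : ℝ) : 0 ≤ stateProb P X k t := measureReal_nonneg

variable [IsProbabilityMeasure P]

theorem cdfProb_succ (hX : ∀ t, Measurable (X t)) (k : ℕ) (t : ℝ) :
    cdfProb P X (k + 1) t = cdfProb P X k t + stateProb P X (k + 1) t := by
  unfold cdfProb stateProb
  rw [← measureReal_union]
  · congr 1
    ext ω
    simp only [Set.mem_ofPred_eq, Set.mem_union]
    omega
  · rw [Set.disjoint_left]
    intro ω h1 h2
    simp only [Set.mem_ofPred_eq] at h1 h2
    omega
  · exact hX _ (measurableSet_singleton (k + 1))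

theorem cdfProb_le_one (k : ℕ) (t : ℝ) : cdfProb P X k t ≤ 1 := measureReal_le_one

theorem IsFractionalBirthProcess.cdfProb_of_nonpos (hX : IsFractionalBirthProcess P ν rate X)
    {k : ℕ} (hk : 1 ≤ k) {t : ℝ} (ht : t ≤ 0) : cdfProb P X k t = 1 := by
  simp [cdfProb, Real.toNNReal_of_nonpos ht, hX.start, hk]

theorem IsFractionalBirthProcess.antitone_cdfProb (hX : IsFractionalBirthProcess P ν rate X)
    (k : ℕ) : Antitone (cdfProb P X k) := fun _ _ hst =>
  measureReal_mono fun ω hω => (hX.mono ω (Real.toNNReal_mono hst)).trans hω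

theorem _root_.Antitone.deriv_le_zero {f : ℝ → ℝ} (hf : Antitone f) (x : ℝ) : deriv f x ≤ 0 := by
  have := (hf.antitoneOn Set.univ).derivWithin_nonpos (x := x)
  rwa [derivWithin_univ] at this

theorem IsFractionalBirthProcess.absolutelyContinuous_cdfProb
    (hX : IsFractionalBirthProcess P ν rate X) (k : ℕ) {b : ℝ} (hb : 0 < b) :
    AbsolutelyContinuousOnInterval (cdfProb P X k) 0 b := by
  induction k with
  | zero =>
    rw [hX.cdfProb_zero]
    simpa [Pi.zero_def] using (hX.absCont 1 le_rfl b hb).const_mul 0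
  | succ k ih =>
    have : cdfProb P X (k + 1) = cdfProb P X k + stateProb P X (k + 1) :=
      funext fun t => cdfProb_succ hX.measurable k t
    rw [this]
    exact ih.add (hX.absCont _ (by omega) b hb)

theorem IsFractionalBirthProcess.continuous_cdfProb (hX : IsFractionalBirthProcess P ν rate X)
    (k : ℕ) : Continuous (cdfProb P X k) := by
  have h0 : ContinuousOn (cdfProb P X k) (Set.Ici 0) := fun t ht => by
    have h := (hX.absolutelyContinuous_cdfProb k (b := t + 1)
      (by linarith [Set.mem_Ici.1 ht])).continuousOn
    rw [Set.uIcc_of_le (by linarith [Set.mem_Ici.1 ht])] at h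
    refine (h t ⟨ht, by linarith⟩).mono_of_mem_nhdsWithin ?_
    rw [← Set.Ici_inter_Iic]
    exact inter_mem_nhdsWithin _ (Iic_mem_nhds (by linarith))
  have h1 : cdfProb P X k = fun t => cdfProb P X k (max t 0) := by
    ext t
    rcases le_total t 0 with h | h
    · simp [cdfProb, max_eq_right h, Real.toNNReal_of_nonpos h]
    · rw [max_eq_left h]
  rw [h1]
  exact h0.comp_continuous (by fun_prop) fun t => le_max_right t 0

/-- Additivity of `deriv` requires differentiability; distribution functions are monotone in time,
hence differentiable almost everywhere, which suffices under the integral. -/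
theorem IsFractionalBirthProcess.ae_deriv_cdfProb_succ
    (hX : IsFractionalBirthProcess P ν rate X) (k : ℕ) :
    ∀ᵐ t, deriv (cdfProb P X (k + 1)) t =
      deriv (cdfProb P X k) t + deriv (stateProb P X (k + 1)) t := by
  have hd : ∀ j, ∀ᵐ t, DifferentiableAt ℝ (cdfProb P X j) t := fun j => by
    filter_upwards [(hX.antitone_cdfProb j).neg.ae_differentiableAt] with t ht
    simpa using ht.neg
  have h : stateProb P X (k + 1) = cdfProb P X (k + 1) - cdfProb P X k := by
    ext t
    simp [cdfProb_succ hX.measurable]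
  filter_upwards [hd k, hd (k + 1)] with t h1 h2
  rw [h, deriv_sub h2 h1]
  ring

/-- The equations for `p_1, …, p_k` telescope. The lower boundary term `rate 0 * p_0` vanishes
because `p_0 = 0`. Passing to distribution functions gains monotonicity: their derivatives have a
constant sign. -/
theorem IsFractionalBirthProcess.caputo_cdfProb (hX : IsFractionalBirthProcess P ν rate X)
    (k : ℕ) {t : ℝ} (ht : 0 < t) :
    IntervalIntegrable (fun s => deriv (cdfProb P X k) s / (t - s) ^ ν) volume 0 t ∧
      caputoDeriv ν (cdfProb P X k) t = -(rate k) * stateProb P X k t := by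
  induction k with
  | zero => simp [hX.cdfProb_zero, hX.stateProb_zero, caputoDeriv, Pi.zero_def]
  | succ k ih =>
    have hae : ∀ᵐ s, deriv (cdfProb P X (k + 1)) s / (t - s) ^ ν =
        deriv (cdfProb P X k) s / (t - s) ^ ν + deriv (stateProb P X (k + 1)) s / (t - s) ^ ν := by
      filter_upwards [hX.ae_deriv_cdfProb_succ k] with s hs
      rw [hs, add_div]
    have hi := hX.integrable (k + 1) (by omega) t ht
    have hc := hX.caputo_eq (k + 1) (by omega) t ht
    refine ⟨(ih.1.add hi).congr_ae (ae_restrict_of_ae (hae.mono fun s hs => hs.symm)), ?_⟩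
    have h2 := ih.2
    unfold caputoDeriv at h2 hc ⊢
    rw [intervalIntegral.integral_congr_ae (hae.mono fun s hs _ => hs),
      intervalIntegral.integral_add ih.1 hi, mul_add, h2, hc]
    simp

/-- The integrated form of the Caputo equations: `1 - P(X_t ≤ k) = λ_k I^ν p_k (t)`. -/
theorem IsFractionalBirthProcess.lconvolution_stateProb
    (hX : IsFractionalBirthProcess P ν rate X) (hν0 : 0 < ν) (hν1 : ν < 1)
    {k : ℕ} (hk : 1 ≤ k) :
    lconvolution ((Set.Ioi 0).indicator fun t => ENNReal.ofReal (rate k * stateProb P X k t))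
      (fun x => ENNReal.ofReal (powKernel ν x)) volume =
        fun t => ENNReal.ofReal (1 - cdfProb P X k t) := by
  have h0 : ∀ c : ℝ, ∀ x ≤ 0, ENNReal.ofReal (powKernel c x) = 0 := fun c x hx => by
    simp [powKernel_of_nonpos hx]
  set h : ℝ → ℝ≥0∞ := (Set.Ioi 0).indicator fun s => ENNReal.ofReal (-deriv (cdfProb P X k) s)
    with hdef
  have hh : Measurable h := Measurable.indicator (by fun_prop) measurableSet_Ioi
  have hh0 : ∀ x ≤ 0, h x = 0 := fun x hx => Set.indicator_of_notMem (by simpa using hx) _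
  have hanti := hX.antitone_cdfProb k
  have hG : 0 < Real.Gamma (1 - ν) := Real.Gamma_pos_of_pos (by linarith)
  -- The Caputo equation read as a convolution: `(t - s)^(-ν) / Γ(1 - ν)` is the kernel of order `1
  -- - ν`. The indicator removes `t ≤ 0`, where `stateProb` is frozen at its value at time `0`.
  have hA : lconvolution h (fun x => ENNReal.ofReal (powKernel (1 - ν) x)) volume =
      (Set.Ioi 0).indicator fun t => ENNReal.ofReal (rate k * stateProb P X k t) := by
    ext t
    rcases le_or_gt t 0 with ht | ht
    · rw [lconvolution_of_nonpos hh0 (h0 _) ht, Set.indicator_of_notMem (by simpa using ht)]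
    obtain ⟨hi, hc⟩ := hX.caputo_cdfProb k ht
    rw [lconvolution_eq_setLIntegral hh0 (h0 _), Set.indicator_of_mem (by simpa using ht)]
    have heq : rate k * stateProb P X k t = ∫ s in (0 : ℝ)..t,
        (1 / Real.Gamma (1 - ν)) * -(deriv (cdfProb P X k) s / (t - s) ^ ν) := by
      rw [intervalIntegral.integral_const_mul, intervalIntegral.integral_neg]
      unfold caputoDeriv at hc
      linarith
    rw [heq, intervalIntegral.integral_of_le ht.le, ofReal_integral_eq_lintegral_ofReal]
    · refine lintegral_congr_ae ?_
      have : ∀ᵐ u : ℝ, u ≠ t := by simp [ae_iff, measure_singleton]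
      filter_upwards [ae_restrict_mem measurableSet_Ioc, ae_restrict_of_ae this] with s hs hne
      have hst : 0 < t - s := sub_pos.2 (lt_of_le_of_ne hs.2 hne)
      rw [hdef, Set.indicator_of_mem (by exact hs.1),
        ← ENNReal.ofReal_mul (neg_nonneg.2 (hanti.deriv_le_zero s)), powKernel_of_pos hst,
        show 1 - ν - 1 = -ν by ring, Real.rpow_neg hst.le]
      congr 1
      field_simp
    · exact ((intervalIntegrable_iff_integrableOn_Ioc_of_le ht.le).1 hi).neg.const_mul _
    · filter_upwards [ae_restrict_mem measurableSet_Ioc] with s hs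
      have := hanti.deriv_le_zero s
      have hst : 0 ≤ t - s := sub_nonneg.2 hs.2
      have h3 : 0 ≤ -(deriv (cdfProb P X k) s / (t - s) ^ ν) := by
        rw [← neg_div]
        exact div_nonneg (by linarith) (by positivity)
      simp only [Pi.zero_apply]
      positivity
  -- The kernel of order `1` is plain integration, so this is the fundamental theorem of calculus
  -- for the absolutely continuous `cdfProb`, which equals `1` at time `0`.
  have hB : lconvolution h (fun x => ENNReal.ofReal (powKernel 1 x)) volume =
      fun t => ENNReal.ofReal (1 - cdfProb P X k t) := by
    ext t
    rcases le_or_gt t 0 with ht | ht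
    · rw [lconvolution_of_nonpos hh0 (h0 _) ht, hX.cdfProb_of_nonpos hk ht]
      simp
    have hac := hX.absolutelyContinuous_cdfProb k ht
    have heq : 1 - cdfProb P X k t = ∫ s in (0 : ℝ)..t, -deriv (cdfProb P X k) s := by
      rw [intervalIntegral.integral_neg, hac.integral_deriv_eq_sub,
        hX.cdfProb_of_nonpos hk le_rfl]
      ring
    rw [lconvolution_eq_setLIntegral hh0 (h0 _), heq, intervalIntegral.integral_of_le ht.le,
      ofReal_integral_eq_lintegral_ofReal]
    · refine lintegral_congr_ae ?_
      have : ∀ᵐ u : ℝ, u ≠ t := by simp [ae_iff, measure_singleton]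
      filter_upwards [ae_restrict_mem measurableSet_Ioc, ae_restrict_of_ae this] with s hs hne
      have hst : 0 < t - s := sub_pos.2 (lt_of_le_of_ne hs.2 hne)
      rw [hdef, Set.indicator_of_mem (by exact hs.1), powKernel_one hst]
      simp
    · exact ((intervalIntegrable_iff_integrableOn_Ioc_of_le ht.le).1
        hac.intervalIntegrable_deriv).neg
    · exact ae_of_all _ fun s => neg_nonneg.2 (hanti.deriv_le_zero s)
  -- Convolving once more with the kernel of order `ν` raises the order from `1 - ν` to `1`.
  rw [← hA, ← hB, ← lconvolution_assoc hh (by fun_prop) (by fun_prop),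
    lconvolution_powKernel (by linarith) hν0, sub_add_cancel]

theorem IsFractionalBirthProcess.continuous_stateProb (hX : IsFractionalBirthProcess P ν rate X)
    (k : ℕ) : Continuous (stateProb P X k) := by
  rcases k with _ | k
  · simp only [funext hX.stateProb_zero]
    exact continuous_const
  · have h : stateProb P X (k + 1) = fun t => cdfProb P X (k + 1) t - cdfProb P X k t := by
      ext t
      simp [cdfProb_succ hX.measurable]
    rw [h]
    exact (hX.continuous_cdfProb _).sub (hX.continuous_cdfProb _)

/-- Writing `p_{k+1}` as a difference of distribution functions makes `1 - F_{k+1} = λ_{k+1} I^ν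
p_{k+1}` an Abel equation for `F_{k+1}` with data `F_k`, ready for induction on `k`. -/
theorem IsFractionalBirthProcess.cdfProb_eq_integral
    (hX : IsFractionalBirthProcess P ν rate X) (hν0 : 0 < ν) (hν1 : ν < 1)
    {k : ℕ} (hrate : 0 ≤ rate (k + 1)) {t : ℝ} (ht : 0 < t) :
    cdfProb P X (k + 1) t = 1 - rate (k + 1) * ∫ u in (0 : ℝ)..t,
      powKernel ν (t - u) * (cdfProb P X (k + 1) u - cdfProb P X k u) := by
  have h := congrFun (hX.lconvolution_stateProb hν0 hν1 (by omega : 1 ≤ k + 1)) t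
  rw [lconvolution_eq_setLIntegral (fun x hx => Set.indicator_of_notMem (by simpa using hx) _)
    (fun x hx => by simp [powKernel_of_nonpos hx])] at h
  have hst : ∀ u, cdfProb P X (k + 1) u - cdfProb P X k u = stateProb P X (k + 1) u := fun u => by
    simp [cdfProb_succ hX.measurable]
  have hi := intervalIntegrable_powKernel_mul_bounded hν0 ht
    (hX.continuous_stateProb (k + 1)).measurable (M := 1) (fun u _ _ => by
      rw [abs_of_nonneg (stateProb_nonneg _ _)]
      exact measureReal_le_one)
  have h2 : ENNReal.ofReal (rate (k + 1) * ∫ u in (0 : ℝ)..t,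
      powKernel ν (t - u) * (cdfProb P X (k + 1) u - cdfProb P X k u)) =
        ENNReal.ofReal (1 - cdfProb P X (k + 1) t) := by
    rw [← h, ← intervalIntegral.integral_const_mul, intervalIntegral.integral_of_le ht.le,
      ofReal_integral_eq_lintegral_ofReal]
    · refine setLIntegral_congr_fun measurableSet_Ioc fun u hu => ?_
      rw [Set.indicator_of_mem (by exact hu.1), hst,
        ← ENNReal.ofReal_mul (mul_nonneg hrate (stateProb_nonneg _ _))]
      congr 1
      ring
    · simp_rw [hst]
      exact ((intervalIntegrable_iff_integrableOn_Ioc_of_le ht.le).1 hi).const_mul _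
    · refine ae_of_all _ fun u => mul_nonneg hrate (mul_nonneg (powKernel_nonneg hν0 _) ?_)
      rw [hst]
      exact stateProb_nonneg _ _
  rw [ENNReal.ofReal_eq_ofReal_iff] at h2
  · linarith
  · refine mul_nonneg hrate (intervalIntegral.integral_nonneg ht.le fun u _ =>
      mul_nonneg (powKernel_nonneg hν0 _) ?_)
    rw [hst]
    exact stateProb_nonneg _ _
  · exact sub_nonneg.2 (cdfProb_le_one _ _)

end StateProbabilities

/-! ### Partial fraction coefficients and the limiting terms -/

section Coeff

variable {rate : ℕ → ℝ}

theorem coeff_succ {k m : ℕ} (hm : m ∈ Finset.Icc 1 k) :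
    coeff rate (k + 1) m = coeff rate k m * (rate (k + 1) / (rate (k + 1) - rate m)) := by
  have hm' := Finset.mem_Icc.1 hm
  have h : (Finset.Icc 1 (k + 1)).erase m = insert (k + 1) ((Finset.Icc 1 k).erase m) := by
    ext l
    simp only [Finset.mem_erase, Finset.mem_Icc, Finset.mem_insert]
    omega
  rw [coeff, h, Finset.prod_insert (by simp), mul_comm]
  rfl

/-- The factor `rate (k + 1) - rate m` cancels the last denominator of `coeff (k + 1) m` and kills
the term `m = k + 1`. This is the algebra behind both recursions in `k`. -/
theorem sum_coeff_mul_sub (hdist : Set.InjOn rate (Set.Ici 1)) (k : ℕ) (e : ℕ → ℝ) :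
    ∑ m ∈ Finset.Icc 1 (k + 1), coeff rate (k + 1) m * ((rate (k + 1) - rate m) * e m) =
      rate (k + 1) * ∑ m ∈ Finset.Icc 1 k, coeff rate k m * e m := by
  rw [Finset.sum_Icc_succ_top (by omega), sub_self, zero_mul, mul_zero, add_zero, Finset.mul_sum]
  refine Finset.sum_congr rfl fun m hm => ?_
  have hm' := Finset.mem_Icc.1 hm
  have : rate (k + 1) - rate m ≠ 0 := sub_ne_zero.2 fun h => by
    have := hdist (Set.mem_Ici.2 (by omega)) (Set.mem_Ici.2 hm'.1) h
    omega
  rw [coeff_succ hm]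
  field_simp

/-- `coeff rate k m` is the value at `0` of the Lagrange basis polynomial of the node `rate m`, and
these polynomials sum to `1`. -/
theorem sum_coeff (hdist : Set.InjOn rate (Set.Ici 1)) {k : ℕ} (hk : 1 ≤ k) :
    ∑ m ∈ Finset.Icc 1 k, coeff rate k m = 1 := by
  have h := Lagrange.sum_basis (s := Finset.Icc 1 k) (v := rate)
    (fun a ha b hb hab => hdist (Finset.mem_Icc.1 ha).1 (Finset.mem_Icc.1 hb).1 hab)
    ⟨1, Finset.mem_Icc.2 ⟨le_rfl, hk⟩⟩
  have h2 := congrArg (Polynomial.eval 0) h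
  rw [Polynomial.eval_finsetSum, Polynomial.eval_one] at h2
  rw [← h2]
  refine Finset.sum_congr rfl fun m _ => ?_
  rw [coeff, Lagrange.basis, Polynomial.eval_prod]
  refine Finset.prod_congr rfl fun l _ => ?_
  simp only [Lagrange.basisDivisor, Polynomial.eval_mul, Polynomial.eval_C, Polynomial.eval_sub,
    Polynomial.eval_X, zero_sub]
  rw [← neg_sub (rate l) (rate m), inv_neg, neg_mul_neg, div_eq_inv_mul]

theorem limitTerm_zero (ν β : ℝ) : limitTerm ν β rate 0 = 1 := by simp [limitTerm]

/-- With `z = β^ν`, split `z + λ_{k+1} = (z + λ_m) + (λ_{k+1} - λ_m)` in each summand. The recursion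
unwinds to `∏_{r ≤ k} λ_r / (z + λ_r)`, which explains nonnegativity. -/
theorem limitTerm_succ {ν β : ℝ} (hβ : 0 < β) (hrate : ∀ r, 1 ≤ r → 0 ≤ rate r)
    (hdist : Set.InjOn rate (Set.Ici 1)) (k : ℕ) :
    (β ^ ν + rate (k + 1)) * limitTerm ν β rate (k + 1) =
      rate (k + 1) * limitTerm ν β rate k := by
  have hz : 0 < β ^ ν := by positivity
  have h1 := sum_coeff_mul_sub hdist k fun m => β ^ ν / (β ^ ν + rate m)
  have h2 : (β ^ ν + rate (k + 1)) * ∑ m ∈ Finset.Icc 1 (k + 1),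
      coeff rate (k + 1) m * (β ^ ν / (β ^ ν + rate m)) =
        β ^ ν * ∑ m ∈ Finset.Icc 1 (k + 1), coeff rate (k + 1) m +
          ∑ m ∈ Finset.Icc 1 (k + 1),
            coeff rate (k + 1) m * ((rate (k + 1) - rate m) * (β ^ ν / (β ^ ν + rate m))) := by
    rw [Finset.mul_sum, Finset.mul_sum, ← Finset.sum_add_distrib]
    refine Finset.sum_congr rfl fun m hm => ?_
    have := hrate m (Finset.mem_Icc.1 hm).1
    have : β ^ ν + rate m ≠ 0 := by positivity
    field_simp
    ring
  rw [h1, sum_coeff hdist (by omega)] at h2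
  unfold limitTerm
  linear_combination -h2

theorem limitTerm_nonneg {ν β : ℝ} (hβ : 0 < β) (hrate : ∀ r, 1 ≤ r → 0 ≤ rate r)
    (hdist : Set.InjOn rate (Set.Ici 1)) (k : ℕ) : 0 ≤ limitTerm ν β rate k := by
  induction k with
  | zero => rw [limitTerm_zero]; exact zero_le_one
  | succ k ih =>
    have hr := hrate (k + 1) (by omega)
    have hz : 0 < β ^ ν + rate (k + 1) := by positivity
    refine nonneg_of_mul_nonneg_right (a := β ^ ν + rate (k + 1)) ?_ hz
    rw [limitTerm_succ hβ hrate hdist]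
    exact mul_nonneg hr ih

end Coeff

/-! ### Integration against the exponential density -/

section ExponentialTime

theorem integral_seriesTerm {ν β t : ℝ} (hβ : 0 < β) (ht : 0 < t) (x : ℝ) (r : ℕ) :
    ∫ s in Set.Ioc 0 t, β * Real.exp (-(β * s)) * ((-x) ^ r * powKernel (ν * r + 1) s) =
      seriesTerm ν β t x r := by
  have h := intervalIntegral.mul_integral_comp_mul_left (a := 0) (b := t)
    (f := fun s => s ^ (ν * r + 1 - 1) * Real.exp (-s)) (c := β)
  rw [mul_zero] at h
  rw [seriesTerm, lowerGamma, ← h, intervalIntegral.integral_of_le ht.le, ← integral_const_mul,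
    div_mul_eq_mul_div, ← integral_mul_const, ← integral_div]
  refine setIntegral_congr_fun measurableSet_Ioc fun s hs => ?_
  have hs0 : 0 < s := hs.1
  rw [powKernel_of_pos hs0, add_sub_cancel_right, Real.mul_rpow hβ.le hs0.le,
    Real.rpow_mul hβ.le ν, Real.rpow_natCast, div_pow]
  have : (β ^ ν) ^ r ≠ 0 := by positivity
  field_simp

theorem integrableOn_exp_mul_powKernel {a β t : ℝ} (ha : 0 < a) (ht : 0 < t) :
    IntegrableOn (fun s => β * Real.exp (-(β * s)) * powKernel a s) (Set.Ioc 0 t) := by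
  have h := intervalIntegrable_powKernel_mul one_pos ha ht
  have h2 : IntervalIntegrable (powKernel a) volume 0 t := by
    refine h.congr_ae ?_
    have : ∀ᵐ u : ℝ, u ≠ t := by simp [ae_iff, measure_singleton]
    filter_upwards [ae_restrict_mem measurableSet_uIoc, ae_restrict_of_ae this] with s hs hne
    rw [Set.uIoc_of_le ht.le] at hs
    rw [powKernel_one (sub_pos.2 (lt_of_le_of_ne hs.2 hne)), one_mul]
  exact (intervalIntegrable_iff_integrableOn_Ioc_of_le ht.le).1
    (h2.continuousOn_mul (by fun_prop))

/-- On `(0, t]` the exponential is at most `1` and the kernels of order `νr + 1 ≥ 1` increase, so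
the integrated norms are dominated by `βt` times a convergent Mittag-Leffler series. This permits
termwise integration. -/
theorem summable_and_integral_seriesTerm {ν β t : ℝ} (hν : 0 < ν) (hβ : 0 < β) (ht : 0 < t) (x : ℝ) :
    Summable (seriesTerm ν β t x) ∧
      ∫ s in Set.Ioc 0 t, β * Real.exp (-(β * s)) * mittagLeffler ν (-x) s =
        ∑' r : ℕ, seriesTerm ν β t x r := by
  have key := hasSum_integral_of_summable_integral_norm
    (F := fun (r : ℕ) s => β * Real.exp (-(β * s)) * ((-x) ^ r * powKernel (ν * r + 1) s))
    (μ := volume.restrict (Set.Ioc 0 t)) (fun r => by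
      have := (integrableOn_exp_mul_powKernel (a := ν * r + 1) (β := β) (by positivity) ht).const_mul
        ((-x) ^ r)
      simpa only [mul_left_comm (_ * Real.exp _)] using this) ?_
  · simp_rw [integral_seriesTerm hβ ht, tsum_mul_left] at key
    exact ⟨key.summable, key.tsum_eq.symm⟩
  · refine Summable.of_nonneg_of_le (fun r => by positivity) (fun r => ?_)
      ((summable_mittagLeffler hν |x| t).mul_left (β * t))
    have hle : ∀ s ∈ Set.Ioc 0 t,
        ‖β * Real.exp (-(β * s)) * ((-x) ^ r * powKernel (ν * r + 1) s)‖ ≤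
          β * (|x| ^ r * powKernel (ν * r + 1) t) := fun s hs => by
      have hs0 : 0 < s := hs.1
      have hg : 0 < Real.Gamma (ν * r + 1) := Real.Gamma_pos_of_pos (by positivity)
      rw [norm_mul, norm_mul, norm_mul, norm_pow, norm_neg, Real.norm_of_nonneg hβ.le,
        Real.norm_of_nonneg (Real.exp_pos _).le,
        Real.norm_of_nonneg (powKernel_nonneg (by positivity) _), Real.norm_eq_abs, mul_assoc]
      refine mul_le_mul_of_nonneg_left ?_ hβ.le
      have h1 : Real.exp (-(β * s)) ≤ 1 := Real.exp_le_one_iff.2 (by nlinarith)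
      have h2 : powKernel (ν * r + 1) s ≤ powKernel (ν * r + 1) t := by
        rw [powKernel_of_pos hs0, powKernel_of_pos ht, add_sub_cancel_right]
        have := hs.2
        gcongr
      have h3 := powKernel_nonneg (a := ν * r + 1) (by positivity) s
      calc _ ≤ 1 * (|x| ^ r * powKernel (ν * r + 1) t) := by gcongr
        _ = _ := one_mul _
    calc _ ≤ ‖∫ s in Set.Ioc 0 t,
          ‖β * Real.exp (-(β * s)) * ((-x) ^ r * powKernel (ν * r + 1) s)‖‖ := le_abs_self _
      _ ≤ β * (|x| ^ r * powKernel (ν * r + 1) t) * volume.real (Set.Ioc 0 t) :=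
          norm_setIntegral_le_of_norm_le_const (by simp) fun s hs => by
            rw [norm_norm]; exact hle s hs
      _ = _ := by
          rw [Real.volume_real_Ioc_of_le ht.le]
          ring

theorem integral_exp_Ioc {β t : ℝ} (ht : 0 ≤ t) :
    ∫ s in Set.Ioc 0 t, β * Real.exp (-(β * s)) = 1 - Real.exp (-(β * t)) := by
  rw [← intervalIntegral.integral_of_le ht,
    intervalIntegral.integral_eq_sub_of_hasDerivAt (f := fun s => -Real.exp (-(β * s)))]
  · simp; ring
  · intro s _
    have := (((hasDerivAt_id s).const_mul β).fun_neg.exp).fun_neg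
    simpa [mul_comm] using this
  · exact Continuous.intervalIntegrable (by fun_prop) _ _

theorem lintegral_exp_Ioi {β : ℝ} (hβ : 0 < β) :
    ∫⁻ s in Set.Ioi 0, ENNReal.ofReal (β * Real.exp (-(β * s))) = 1 := by
  rw [← lintegral_exponentialPDF_eq_one hβ, ← lintegral_indicator measurableSet_Ioi]
  refine lintegral_congr_ae ?_
  have : ∀ᵐ u : ℝ, u ≠ 0 := by simp [ae_iff, measure_singleton]
  filter_upwards [this] with s hs
  rcases lt_or_gt_of_ne hs with h | h
  · rw [Set.indicator_of_notMem (by simpa using h.le), exponentialPDF_of_neg h]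
  · rw [Set.indicator_of_mem (by exact h), exponentialPDF_of_nonneg h.le]

end ExponentialTime

/-! ### Explicit distribution functions and their exponential averages -/

section StateProbabilities

variable {Ω : Type*} [MeasurableSpace Ω] {P : Measure Ω} [IsProbabilityMeasure P]
  {ν β : ℝ} {rate : ℕ → ℝ} {X : ℝ≥0 → Ω → ℕ}

/-- The state probabilities in terms of Mittag-Leffler functions. -/
theorem IsFractionalBirthProcess.cdfProb_eq_sum
    (hX : IsFractionalBirthProcess P ν rate X) (hν0 : 0 < ν) (hν1 : ν < 1)
    (hrate : ∀ r, 1 ≤ r → 0 ≤ rate r) (hdist : Set.InjOn rate (Set.Ici 1))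
    (k : ℕ) {t : ℝ} (ht : 0 < t) :
    cdfProb P X k t =
      ∑ m ∈ Finset.Icc 1 k, coeff rate k m * mittagLeffler ν (-rate m) t := by
  induction k generalizing t with
  | zero => simp [hX.cdfProb_zero]
  | succ k ih =>
    set F : ℝ → ℝ := fun t =>
      ∑ m ∈ Finset.Icc 1 (k + 1), coeff rate (k + 1) m * mittagLeffler ν (-rate m) t with hF
    set C : ℝ := ∑ m ∈ Finset.Icc 1 (k + 1),
      |coeff rate (k + 1) m| * mittagLeffler ν |(-rate m)| t with hC
    have hFm : Measurable F := Finset.measurable_fun_sum _ fun m _ =>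
      (measurable_mittagLeffler hν0 _).const_mul _
    have hFb : ∀ s, 0 < s → s ≤ t → |F s| ≤ C := fun s hs hst =>
      (Finset.abs_sum_le_sum_abs _ _).trans <| Finset.sum_le_sum fun m _ => by
        rw [abs_mul]
        gcongr
        exact abs_mittagLeffler_le hν0 _ hs hst
    have hEi : ∀ m s, 0 < s → IntervalIntegrable
        (fun u => powKernel ν (s - u) * mittagLeffler ν (-rate m) u) volume 0 s := fun m s hs =>
      intervalIntegrable_powKernel_mul_bounded hν0 hs (measurable_mittagLeffler hν0 _)
        fun u hu hus => abs_mittagLeffler_le hν0 _ hu hus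
    have hSb : ∀ (j : ℕ) (u : ℝ), |cdfProb P X j u| ≤ 1 := fun j u => by
      rw [abs_of_nonneg (cdfProb_nonneg _ _)]
      exact cdfProb_le_one _ _
    have hSi : ∀ j s, 0 < s → IntervalIntegrable
        (fun u => powKernel ν (s - u) * cdfProb P X j u) volume 0 s := fun j s hs =>
      intervalIntegrable_powKernel_mul_bounded hν0 hs (hX.continuous_cdfProb j).measurable
        fun u _ _ => hSb j u
    have hsum : ∀ j s, 0 < s → ∫ u in (0 : ℝ)..s, powKernel ν (s - u) *
        ∑ m ∈ Finset.Icc 1 j, coeff rate j m * mittagLeffler ν (-rate m) u =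
          ∑ m ∈ Finset.Icc 1 j, coeff rate j m *
            ∫ u in (0 : ℝ)..s, powKernel ν (s - u) * mittagLeffler ν (-rate m) u := by
      intro j s hs
      simp_rw [Finset.mul_sum, mul_left_comm (powKernel ν _)]
      rw [intervalIntegral.integral_finsetSum fun m _ => (hEi m s hs).const_mul _]
      simp_rw [intervalIntegral.integral_const_mul]
    -- The candidate satisfies the Abel equation of `cdfProb P X (k + 1)`: apply the Mittag-Leffler
    -- equation to each summand, with `sum_coeff` for the constant and `sum_coeff_mul_sub` for the
    -- data.
    have hFeq : ∀ s, 0 < s → F s = 1 - rate (k + 1) * ∫ u in (0 : ℝ)..s,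
        powKernel ν (s - u) * (F u - cdfProb P X k u) := by
      intro s hs
      have hk : ∫ u in (0 : ℝ)..s, powKernel ν (s - u) * cdfProb P X k u =
          ∫ u in (0 : ℝ)..s, powKernel ν (s - u) *
            ∑ m ∈ Finset.Icc 1 k, coeff rate k m * mittagLeffler ν (-rate m) u := by
        refine intervalIntegral.integral_congr_ae (ae_of_all _ fun u hu => ?_)
        rw [Set.uIoc_of_le hs.le] at hu
        rw [ih hu.1]
      have hFi : IntervalIntegrable (fun u => powKernel ν (s - u) * F u) volume 0 s := by
        simp only [hF, Finset.mul_sum, mul_left_comm (powKernel ν _)]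
        have := IntervalIntegrable.sum (Finset.Icc 1 (k + 1))
          fun m (_ : m ∈ Finset.Icc 1 (k + 1)) =>
            (hEi m s hs).const_mul (coeff rate (k + 1) m)
        simpa [Finset.sum_fn] using this
      simp_rw [mul_sub]
      rw [intervalIntegral.integral_sub hFi (hSi k s hs), hk, hsum k s hs, mul_sub,
        ← sum_coeff_mul_sub hdist, hF, hsum (k + 1) s hs, Finset.mul_sum,
        ← Finset.sum_sub_distrib]
      simp only
      rw [← sum_coeff hdist (by omega : 1 ≤ k + 1), ← Finset.sum_sub_distrib]
      refine Finset.sum_congr rfl fun m _ => ?_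
      rw [mittagLeffler_eq hν0 _ hs]
      ring
    -- The difference of the two solutions is bounded on `(0, t]` and solves the homogeneous
    -- equation.
    have hd := eq_zero_of_abel_equation hν0 (x := -rate (k + 1)) (T := t) (M := 1 + C)
      (d := fun s => cdfProb P X (k + 1) s - F s)
      (fun s hs hst => (abs_sub _ _).trans (add_le_add (hSb _ _) (hFb s hs hst)))
      (fun s hs hst => by
        have h1 := hX.cdfProb_eq_integral hν0 hν1 (hrate (k + 1) (by omega)) hs
        have hFi := intervalIntegrable_powKernel_mul_bounded hν0 hs hFm
          fun u hu hus => hFb u hu (hus.trans hst)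
        rw [h1, hFeq s hs]
        simp_rw [mul_sub]
        rw [intervalIntegral.integral_sub (hSi _ s hs) (hSi _ s hs),
          intervalIntegral.integral_sub hFi (hSi _ s hs),
          intervalIntegral.integral_sub (hSi _ s hs) hFi]
        ring) ht le_rfl
    exact sub_eq_zero.1 hd

theorem IsFractionalBirthProcess.setLIntegral_Ioc_one_sub_cdfProb
    (hX : IsFractionalBirthProcess P ν rate X) (hν0 : 0 < ν) (hν1 : ν < 1) (hβ : 0 < β)
    (hrate : ∀ r, 1 ≤ r → 0 ≤ rate r) (hdist : Set.InjOn rate (Set.Ici 1))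
    (k : ℕ) {t : ℝ} (ht : 0 < t) :
    0 ≤ meanTerm ν β rate t k ∧
    ∫⁻ s in Set.Ioc 0 t, ENNReal.ofReal (β * Real.exp (-(β * s))) *
        ENNReal.ofReal (1 - cdfProb P X k s) =
      ENNReal.ofReal ((1 - Real.exp (-(β * t))) * meanTerm ν β rate t k) := by
  have hq : 0 < 1 - Real.exp (-(β * t)) := by
    rw [sub_pos, Real.exp_lt_one_iff]
    nlinarith
  have hei : IntegrableOn (fun s => β * Real.exp (-(β * s))) (Set.Ioc 0 t) :=
    (Continuous.integrableOn_Icc (by fun_prop)).mono_set Set.Ioc_subset_Icc_self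
  have hci : IntegrableOn (fun s => β * Real.exp (-(β * s)) * cdfProb P X k s) (Set.Ioc 0 t) :=
    ((((continuous_const.mul (by fun_prop)).mul
      (hX.continuous_cdfProb k))).integrableOn_Icc).mono_set Set.Ioc_subset_Icc_self
  have hmi : ∀ m, IntegrableOn
      (fun s => β * Real.exp (-(β * s)) * mittagLeffler ν (-rate m) s) (Set.Ioc 0 t) := fun m => by
    refine (hei.mul_const (mittagLeffler ν |(-rate m)| t)).mono'
      (((by fun_prop : Measurable fun s => β * Real.exp (-(β * s))).mul
        (measurable_mittagLeffler hν0 _)).aestronglyMeasurable) ?_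
    filter_upwards [ae_restrict_mem measurableSet_Ioc] with s hs
    rw [norm_mul, Real.norm_of_nonneg (by positivity), Real.norm_eq_abs]
    gcongr
    exact abs_mittagLeffler_le hν0 _ hs.1 hs.2
  have h1 : ∫ s in Set.Ioc 0 t, β * Real.exp (-(β * s)) * cdfProb P X k s =
      ∑ m ∈ Finset.Icc 1 k, coeff rate k m * ∑' r : ℕ, seriesTerm ν β t (rate m) r := by
    have h2 : ∫ s in Set.Ioc 0 t, β * Real.exp (-(β * s)) * cdfProb P X k s =
        ∫ s in Set.Ioc 0 t, ∑ m ∈ Finset.Icc 1 k,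
          coeff rate k m * (β * Real.exp (-(β * s)) * mittagLeffler ν (-rate m) s) := by
      refine setIntegral_congr_fun measurableSet_Ioc fun s hs => ?_
      rw [hX.cdfProb_eq_sum hν0 hν1 hrate hdist k hs.1, Finset.mul_sum]
      exact Finset.sum_congr rfl fun m _ => by ring
    rw [h2, integral_finsetSum _ fun m _ => (hmi m).const_mul _]
    refine Finset.sum_congr rfl fun m _ => ?_
    rw [integral_const_mul, (summable_and_integral_seriesTerm hν0 hβ ht (rate m)).2]
  have h3 : ∫ s in Set.Ioc 0 t, β * Real.exp (-(β * s)) * (1 - cdfProb P X k s) =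
      (1 - Real.exp (-(β * t))) * meanTerm ν β rate t k := by
    simp_rw [mul_sub, mul_one]
    rw [integral_sub hei hci, h1, integral_exp_Ioc ht.le, meanTerm]
    field_simp
  have hnn : ∀ s, 0 ≤ β * Real.exp (-(β * s)) * (1 - cdfProb P X k s) := fun s =>
    mul_nonneg (by positivity) (sub_nonneg.2 (cdfProb_le_one _ _))
  refine ⟨nonneg_of_mul_nonneg_right (h3 ▸ integral_nonneg hnn) hq, ?_⟩
  rw [← h3, ofReal_integral_eq_lintegral_ofReal _ (ae_of_all _ hnn)]
  · exact lintegral_congr fun s => (ENNReal.ofReal_mul (by positivity)).symm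
  · simp_rw [mul_sub, mul_one]
    exact hei.sub hci

/-- Proved by induction through the Laplace transform, which avoids integrating the Mittag-Leffler
series over an infinite range. -/
theorem IsFractionalBirthProcess.setLIntegral_Ioi_one_sub_cdfProb
    (hX : IsFractionalBirthProcess P ν rate X) (hν0 : 0 < ν) (hν1 : ν < 1) (hβ : 0 < β)
    (hrate : ∀ r, 1 ≤ r → 0 ≤ rate r) (hdist : Set.InjOn rate (Set.Ici 1)) (k : ℕ) :
    ∫⁻ s in Set.Ioi 0, ENNReal.ofReal (β * Real.exp (-(β * s))) *
        ENNReal.ofReal (1 - cdfProb P X k s) =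
      ENNReal.ofReal (limitTerm ν β rate k) := by
  induction k with
  | zero => simp [hX.cdfProb_zero, limitTerm_zero, lintegral_exp_Ioi hβ]
  | succ k ih =>
    have hr := hrate (k + 1) (by omega)
    have hz : 0 < β ^ ν := by positivity
    have hms := (hX.continuous_stateProb (k + 1)).measurable
    have hmc := fun j => (hX.continuous_cdfProb j).measurable
    set B := ∫⁻ s in Set.Ioi 0, ENNReal.ofReal (β * Real.exp (-(β * s))) *
      ENNReal.ofReal (1 - cdfProb P X (k + 1) s) with hBdef
    set D := ∫⁻ s in Set.Ioi 0, ENNReal.ofReal (β * Real.exp (-(β * s))) *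
      ENNReal.ofReal (stateProb P X (k + 1) s) with hD
    -- `(1 - F_{k+1}) + p_{k+1} = 1 - F_k`.
    have hadd : B + D = ENNReal.ofReal (limitTerm ν β rate k) := by
      rw [← ih, ← lintegral_add_left (by fun_prop)]
      refine lintegral_congr fun s => ?_
      rw [← mul_add, ← ENNReal.ofReal_add (sub_nonneg.2 (cdfProb_le_one _ _))
        (stateProb_nonneg _ _), cdfProb_succ hX.measurable]
      congr 2
      ring
    have hL := lintegral_exp_mul_lconvolution
      (f := (Set.Ioi 0).indicator fun t =>
        ENNReal.ofReal (rate (k + 1) * stateProb P X (k + 1) t))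
      (g := fun x => ENNReal.ofReal (powKernel ν x))
      (Measurable.indicator (by fun_prop) measurableSet_Ioi) (by fun_prop) β
    rw [hX.lconvolution_stateProb hν0 hν1 (by omega), lintegral_exp_mul_powKernel hν0 hβ] at hL
    have hB : B = ENNReal.ofReal β * ∫⁻ x, ENNReal.ofReal (Real.exp (-(β * x))) *
        ENNReal.ofReal (1 - cdfProb P X (k + 1) x) := by
      rw [hBdef, ← lintegral_const_mul _ (by fun_prop), ← lintegral_indicator measurableSet_Ioi]
      refine lintegral_congr fun s => ?_
      by_cases hs : s ∈ Set.Ioi 0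
      · rw [Set.indicator_of_mem hs, ENNReal.ofReal_mul hβ.le, mul_assoc]
      · rw [Set.indicator_of_notMem hs, hX.cdfProb_of_nonpos (by omega) (by simpa using hs)]
        simp
    have hD2 : ENNReal.ofReal (rate (k + 1)) * D = ENNReal.ofReal β *
        ∫⁻ x, ENNReal.ofReal (Real.exp (-(β * x))) * (Set.Ioi 0).indicator (fun t =>
          ENNReal.ofReal (rate (k + 1) * stateProb P X (k + 1) t)) x := by
      have hmi : Measurable ((Set.Ioi 0).indicator (fun t =>
          ENNReal.ofReal (rate (k + 1) * stateProb P X (k + 1) t))) :=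
        Measurable.indicator (by fun_prop) measurableSet_Ioi
      rw [hD, ← lintegral_const_mul _ (by fun_prop), ← lintegral_const_mul _ (by fun_prop),
        ← lintegral_indicator measurableSet_Ioi]
      refine lintegral_congr fun s => ?_
      by_cases hs : s ∈ Set.Ioi 0
      · rw [Set.indicator_of_mem hs, Set.indicator_of_mem hs, ENNReal.ofReal_mul hβ.le,
          ENNReal.ofReal_mul hr]
        ring
      · rw [Set.indicator_of_notMem hs, Set.indicator_of_notMem hs]
        simp
    -- The transform of `1 - F_{k+1} = λ_{k+1} I^ν p_{k+1}` at `β`, where `I^ν` becomes the factor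
    -- `β^(-ν)`. Eliminating `D` between this and `hadd` gives the recursion of `limitTerm`.
    have hBD : B = ENNReal.ofReal (rate (k + 1)) * D * ENNReal.ofReal (1 / β ^ ν) := by
      rw [hB, hL, hD2, mul_assoc]
    have hBtop : B ≠ ∞ := ne_top_of_le_ne_top ENNReal.ofReal_ne_top (le_self_add.trans_eq hadd)
    have hDtop : D ≠ ∞ := ne_top_of_le_ne_top ENNReal.ofReal_ne_top (le_add_self.trans_eq hadd)
    have e1 : B.toReal + D.toReal = limitTerm ν β rate k := by
      rw [← ENNReal.toReal_add hBtop hDtop, hadd,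
        ENNReal.toReal_ofReal (limitTerm_nonneg hβ hrate hdist k)]
    have e2 : B.toReal = rate (k + 1) * D.toReal * (1 / β ^ ν) := by
      rw [hBD, ENNReal.toReal_mul, ENNReal.toReal_mul, ENNReal.toReal_ofReal hr,
        ENNReal.toReal_ofReal (by positivity)]
    have e3 : B.toReal = limitTerm ν β rate (k + 1) := by
      have h := limitTerm_succ (ν := ν) hβ hrate hdist k
      have hne : β ^ ν + rate (k + 1) ≠ 0 := by positivity
      refine mul_left_cancel₀ hne ?_
      rw [h, ← e1]
      field_simp at e2
      linear_combination e2
    rw [← e3, ENNReal.ofReal_toReal hBtop]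

end StateProbabilities

/-! ### Adding an independent exponential waiting time -/

section Waiting

variable {Ω : Type*} [MeasurableSpace Ω] {P : Measure Ω} [IsProbabilityMeasure P]

theorem setLIntegral_exp_Ioi {c a : ℝ} (hc : 0 < c) :
    ∫⁻ x in Set.Ioi a, ENNReal.ofReal (c * Real.exp (-(c * x))) =
      ENNReal.ofReal (Real.exp (-(c * a))) := by
  have h := integrableOn_exp_mul_Ioi (neg_lt_zero.2 hc) a
  have h2 := integral_exp_mul_Ioi (neg_lt_zero.2 hc) a
  have h3 : Real.exp (-(c * a)) = ∫ x in Set.Ioi a, c * Real.exp (-(c * x)) := by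
    rw [integral_const_mul]
    simp only [neg_mul] at h2
    rw [h2]
    field_simp
  simp only [neg_mul] at h
  rw [h3, ofReal_integral_eq_lintegral_ofReal (h.const_mul c)]
  exact ae_of_all _ fun x => by positivity

theorem lintegral_expMeasure (c : ℝ) {ψ : ℝ → ℝ≥0∞} (hψ : Measurable ψ) :
    ∫⁻ x, ψ x ∂(expMeasure c) =
      ∫⁻ x in Set.Ioi 0, ENNReal.ofReal (c * Real.exp (-(c * x))) * ψ x := by
  have hm : Measurable (exponentialPDF c) := by
    unfold exponentialPDF
    fun_prop
  change ∫⁻ x, ψ x ∂(volume.withDensity (exponentialPDF c)) = _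
  rw [lintegral_withDensity_eq_lintegral_mul _ hm hψ, ← lintegral_indicator measurableSet_Ioi]
  refine lintegral_congr_ae ?_
  have : ∀ᵐ u : ℝ, u ≠ 0 := by simp [ae_iff, measure_singleton]
  filter_upwards [this] with s hs
  rcases lt_or_gt_of_ne hs with h | h
  · rw [Set.indicator_of_notMem (by simpa using h.le), Pi.mul_apply, exponentialPDF_of_neg h,
      zero_mul]
  · rw [Set.indicator_of_mem (by exact h), Pi.mul_apply, exponentialPDF_of_nonneg h.le]

/-- Integration over an independent pair. -/
theorem lintegral_indepFun {α γ : Type*} [MeasurableSpace α] [MeasurableSpace γ]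
    {Y : Ω → α} {V : Ω → γ} (hY : Measurable Y) (hV : Measurable V) (hYV : IndepFun Y V P)
    {F : α × γ → ℝ≥0∞} (hF : Measurable F) :
    ∫⁻ ω, F (Y ω, V ω) ∂P = ∫⁻ ω, ∫⁻ v, F (Y ω, v) ∂(P.map V) ∂P := by
  have h := (indepFun_iff_map_prod_eq_prod_map_map hY.aemeasurable hV.aemeasurable).1 hYV
  rw [← lintegral_map (f := F) hF (hY.prodMk hV), h, lintegral_prod _ hF.aemeasurable,
    lintegral_map (hF.lintegral_prod_right') hY]

/-- Adding an exponential waiting time to a time with known (weighted) density. -/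
theorem lintegral_add_wait {Z : Ω → ℝ≥0∞} {T V : Ω → ℝ} (hZ : Measurable Z) (hT : Measurable T)
    (hV : Measurable V) {c : ℝ} (hlaw : HasLaw V (expMeasure c) P)
    (hind : IndepFun (fun ω => (Z ω, T ω)) V P) {m : ℝ → ℝ≥0∞}
    (hm : ∀ ψ : ℝ → ℝ≥0∞, Measurable ψ →
      ∫⁻ ω, Z ω * ψ (T ω) ∂P = ∫⁻ s in Set.Ioi 0, m s * ψ s)
    {ψ : ℝ × ℝ → ℝ≥0∞} (hψ : Measurable ψ) :
    ∫⁻ ω, Z ω * ψ (T ω, V ω) ∂P = ∫⁻ u in Set.Ioi 0, m u *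
      ∫⁻ v in Set.Ioi 0, ENNReal.ofReal (c * Real.exp (-(c * v))) * ψ (u, v) := by
  rw [lintegral_indepFun (F := fun p => p.1.1 * ψ (p.1.2, p.2)) (hZ.prodMk hT) hV hind
    (by fun_prop)]
  simp_rw [hlaw.map_eq]
  have h1 : ∀ u, ∫⁻ v, ψ (u, v) ∂(expMeasure c) =
      ∫⁻ v in Set.Ioi 0, ENNReal.ofReal (c * Real.exp (-(c * v))) * ψ (u, v) := fun u =>
    lintegral_expMeasure c (by fun_prop)
  have h2 : ∀ ω, ∫⁻ v, Z ω * ψ (T ω, v) ∂(expMeasure c) =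
      Z ω * ∫⁻ v in Set.Ioi 0, ENNReal.ofReal (c * Real.exp (-(c * v))) * ψ (T ω, v) := fun ω => by
    rw [lintegral_const_mul _ (by fun_prop), h1]
  simp only [h2]
  refine hm (fun u => ∫⁻ v in Set.Ioi 0, ENNReal.ofReal (c * Real.exp (-(c * v))) * ψ (u, v)) ?_
  exact Measurable.lintegral_prod_right' (f := fun p : ℝ × ℝ =>
    ENNReal.ofReal (c * Real.exp (-(c * p.2))) * ψ p) (by fun_prop)

theorem setLIntegral_exp_mul_deriv {c : ℝ} {F f : ℝ → ℝ} (hF0 : F 0 = 0)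
    (hF : ∀ s, HasDerivAt F (f s) s) (hf : Continuous f) (hf0 : ∀ s, 0 ≤ s → 0 ≤ f s)
    {t : ℝ} (ht : 0 ≤ t) :
    ∫⁻ u in Set.Ioc 0 t, ENNReal.ofReal (Real.exp (-(c * u)) * f u) *
      ENNReal.ofReal (Real.exp (-(c * (t - u)))) = ENNReal.ofReal (Real.exp (-(c * t)) * F t) := by
  have h1 : F t = ∫ u in Set.Ioc 0 t, f u := by
    rw [← intervalIntegral.integral_of_le ht,
      intervalIntegral.integral_eq_sub_of_hasDerivAt (fun s _ => hF s)
        (hf.intervalIntegrable _ _), hF0, sub_zero]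
  rw [h1, ← integral_const_mul, ofReal_integral_eq_lintegral_ofReal]
  · refine setLIntegral_congr_fun measurableSet_Ioc fun u hu => ?_
    have := hf0 u hu.1.le
    rw [← ENNReal.ofReal_mul (by positivity)]
    congr 1
    rw [mul_right_comm, ← Real.exp_add]
    congr 2
    ring
  · exact (hf.integrableOn_Icc.mono_set Set.Ioc_subset_Icc_self).const_mul _
  · filter_upwards [ae_restrict_mem measurableSet_Ioc] with u hu
    exact mul_nonneg (Real.exp_pos _).le (hf0 u hu.1.le)

/-- The density of the sum of a time and an independent exponential time. -/
theorem lintegral_add_wait_density {Z : Ω → ℝ≥0∞} {T V : Ω → ℝ} (hZ : Measurable Z)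
    (hT : Measurable T) (hV : Measurable V) {c : ℝ} (hc : 0 < c)
    (hlaw : HasLaw V (expMeasure c) P)
    (hind : IndepFun (fun ω => (Z ω, T ω)) V P) {F f : ℝ → ℝ} (hF0 : F 0 = 0)
    (hF : ∀ s, HasDerivAt F (f s) s) (hf : Continuous f) (hf0 : ∀ s, 0 ≤ s → 0 ≤ f s)
    (hm : ∀ ψ : ℝ → ℝ≥0∞, Measurable ψ → ∫⁻ ω, Z ω * ψ (T ω) ∂P =
      ∫⁻ s in Set.Ioi 0, ENNReal.ofReal (Real.exp (-(c * s)) * f s) * ψ s)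
    {ψ : ℝ → ℝ≥0∞} (hψ : Measurable ψ) :
    ∫⁻ ω, Z ω * ψ (T ω + V ω) ∂P =
      ∫⁻ s in Set.Ioi 0, ENNReal.ofReal (c * Real.exp (-(c * s)) * F s) * ψ s := by
  rw [lintegral_add_wait hZ hT hV hlaw hind hm (ψ := fun p => ψ (p.1 + p.2)) (by fun_prop)]
  have h1 : ∀ u : ℝ, ∫⁻ v in Set.Ioi 0, ENNReal.ofReal (c * Real.exp (-(c * v))) * ψ (u + v) =
      ∫⁻ s in Set.Ioi u, ENNReal.ofReal (c * Real.exp (-(c * (s - u)))) * ψ s := fun u => by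
    rw [← lintegral_indicator measurableSet_Ioi, ← lintegral_indicator measurableSet_Ioi,
      ← lintegral_add_left_eq_self ((Set.Ioi u).indicator fun s =>
        ENNReal.ofReal (c * Real.exp (-(c * (s - u)))) * ψ s) u]
    refine lintegral_congr fun v => ?_
    by_cases hv : 0 < v
    · rw [Set.indicator_of_mem (by exact hv), Set.indicator_of_mem (by simpa using hv),
        add_sub_cancel_left]
    · rw [Set.indicator_of_notMem (by simpa using hv), Set.indicator_of_notMem (by simpa using hv)]
  simp_rw [h1]
  have h2 : ∀ u : ℝ, ENNReal.ofReal (Real.exp (-(c * u)) * f u) *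
      ∫⁻ s in Set.Ioi u, ENNReal.ofReal (c * Real.exp (-(c * (s - u)))) * ψ s =
      ∫⁻ s, (Set.Ioi u).indicator (fun s => ENNReal.ofReal (Real.exp (-(c * u)) * f u) *
        (ENNReal.ofReal (c * Real.exp (-(c * (s - u)))) * ψ s)) s := fun u => by
    rw [lintegral_indicator measurableSet_Ioi, lintegral_const_mul _ (by fun_prop)]
  simp_rw [h2]
  -- Tonelli: for a fixed end `s` of the waiting time, its start `u` runs over `(0, s)`, and the
  -- exponentials combine to `e^(-cs)`. A weighted density `e^(-cs) F'(s)` thus becomes `c e^(-cs)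
  -- F(s)`.
  rw [lintegral_lintegral_swap, ← lintegral_indicator measurableSet_Ioi]
  · refine lintegral_congr fun s => ?_
    have h3 : ∀ u : ℝ, (Set.Ioi u).indicator (fun s => ENNReal.ofReal (Real.exp (-(c * u)) * f u) *
        (ENNReal.ofReal (c * Real.exp (-(c * (s - u)))) * ψ s)) s =
        (Set.Iio s).indicator (fun u => ENNReal.ofReal (Real.exp (-(c * u)) * f u) *
        (ENNReal.ofReal (c * Real.exp (-(c * (s - u)))) * ψ s)) u := fun u => by
      by_cases hu : u < s
      · rw [Set.indicator_of_mem (by exact hu), Set.indicator_of_mem (by exact hu)]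
      · rw [Set.indicator_of_notMem (by exact hu), Set.indicator_of_notMem (by exact hu)]
    simp_rw [h3]
    rw [setLIntegral_indicator measurableSet_Iio, Set.inter_comm, Set.Ioi_inter_Iio]
    rcases le_or_gt s 0 with hs | hs
    · rw [Set.Ioo_eq_empty hs.not_gt, Set.indicator_of_notMem (by simpa using hs)]
      simp
    · rw [Set.indicator_of_mem (by exact hs), setLIntegral_congr Ioo_ae_eq_Ioc, mul_assoc c,
        ENNReal.ofReal_mul hc.le, ← setLIntegral_exp_mul_deriv hF0 hF hf hf0 hs.le, mul_assoc,
        ← lintegral_mul_const _ (by fun_prop), ← lintegral_const_mul _ (by fun_prop)]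
      refine lintegral_congr fun u => ?_
      rw [ENNReal.ofReal_mul hc.le]
      ring
  · have : Measurable (Function.uncurry fun u s : ℝ => (Set.Ioi u).indicator (fun s =>
        ENNReal.ofReal (Real.exp (-(c * u)) * f u) *
        (ENNReal.ofReal (c * Real.exp (-(c * (s - u)))) * ψ s)) s) := by
      have h4 : (Function.uncurry fun u s : ℝ => (Set.Ioi u).indicator (fun s =>
        ENNReal.ofReal (Real.exp (-(c * u)) * f u) *
        (ENNReal.ofReal (c * Real.exp (-(c * (s - u)))) * ψ s)) s) =
        {p : ℝ × ℝ | p.1 < p.2}.indicator fun p =>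
          ENNReal.ofReal (Real.exp (-(c * p.1)) * f p.1) *
          (ENNReal.ofReal (c * Real.exp (-(c * (p.2 - p.1)))) * ψ p.2) := by
        ext p
        simp [Function.uncurry, Set.indicator]
      rw [h4]
      exact Measurable.indicator (by fun_prop) (measurableSet_lt measurable_fst measurable_snd)
    exact this.aemeasurable

/-- The weighted probability that `t` lies between a time and its sum with an independent
exponential time. -/
theorem lintegral_between {Z : Ω → ℝ≥0∞} {T V : Ω → ℝ} (hZ : Measurable Z)
    (hT : Measurable T) (hV : Measurable V) {c : ℝ} (hc : 0 < c)
    (hlaw : HasLaw V (expMeasure c) P)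
    (hind : IndepFun (fun ω => (Z ω, T ω)) V P) {F f : ℝ → ℝ} (hF0 : F 0 = 0)
    (hF : ∀ s, HasDerivAt F (f s) s) (hf : Continuous f) (hf0 : ∀ s, 0 ≤ s → 0 ≤ f s)
    (hm : ∀ ψ : ℝ → ℝ≥0∞, Measurable ψ → ∫⁻ ω, Z ω * ψ (T ω) ∂P =
      ∫⁻ s in Set.Ioi 0, ENNReal.ofReal (Real.exp (-(c * s)) * f s) * ψ s)
    {t : ℝ} (ht : 0 ≤ t) :
    ∫⁻ ω in {ω | T ω ≤ t ∧ t < T ω + V ω}, Z ω ∂P =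
      ENNReal.ofReal (Real.exp (-(c * t)) * F t) := by
  have hS : MeasurableSet {p : ℝ × ℝ | p.1 ≤ t ∧ t < p.1 + p.2} :=
    (measurableSet_le measurable_fst measurable_const).inter
      (measurableSet_lt measurable_const (measurable_fst.add measurable_snd))
  have hS' : MeasurableSet {ω | T ω ≤ t ∧ t < T ω + V ω} := (hT.prodMk hV) hS
  have h1 := lintegral_add_wait hZ hT hV hlaw hind hm
    (ψ := {p : ℝ × ℝ | p.1 ≤ t ∧ t < p.1 + p.2}.indicator 1) (measurable_one.indicator hS)
  have h2 : ∫⁻ ω in {ω | T ω ≤ t ∧ t < T ω + V ω}, Z ω ∂P =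
      ∫⁻ ω, Z ω * {p : ℝ × ℝ | p.1 ≤ t ∧ t < p.1 + p.2}.indicator 1 (T ω, V ω) ∂P := by
    rw [← lintegral_indicator hS']
    refine lintegral_congr fun ω => ?_
    by_cases h : T ω ≤ t ∧ t < T ω + V ω
    · rw [Set.indicator_of_mem (by exact h), Set.indicator_of_mem (by exact h)]
      simp
    · rw [Set.indicator_of_notMem (by exact h), Set.indicator_of_notMem (by exact h)]
      simp
  rw [h2, h1, ← setLIntegral_exp_mul_deriv hF0 hF hf hf0 ht,
    ← lintegral_indicator measurableSet_Ioi, ← lintegral_indicator measurableSet_Ioc]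
  refine lintegral_congr fun u => ?_
  by_cases hu : 0 < u
  swap
  · rw [Set.indicator_of_notMem (by simpa using hu), Set.indicator_of_notMem (by simp [hu])]
  rw [Set.indicator_of_mem (by exact hu)]
  by_cases hut : u ≤ t
  -- For `0 < u ≤ t` the inner integral is the exponential tail beyond `t - u`.
  · rw [Set.indicator_of_mem (show u ∈ Set.Ioc 0 t from ⟨hu, hut⟩), ← setLIntegral_exp_Ioi hc,
      ← lintegral_indicator measurableSet_Ioi, ← lintegral_indicator measurableSet_Ioi]
    congr 1
    refine lintegral_congr fun v => ?_
    by_cases hv : t - u < v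
    · have hv0 : 0 < v := by linarith
      have hp : u ≤ t ∧ t < u + v := ⟨hut, by linarith⟩
      simp [Set.indicator, hv, hv0, hp]
    · have hp : ¬ (u ≤ t ∧ t < u + v) := fun h => hv (by linarith [h.2])
      simp [Set.indicator, hv, hp]
  · simp [Set.indicator, hut]

end Waiting

/-! ### Creation times in the Yule process and the age of a uniformly drawn page -/

section Yule

theorem creationTime_succ {Ω : Type*} (W : ℕ → Ω → ℝ) (n : ℕ) (ω : Ω) :
    creationTime W (n + 1) ω = creationTime W n ω + W n ω :=
  Finset.sum_range_succ _ _

theorem creationTime_eq_of_past {Ω : Type*} (W : ℕ → Ω → ℝ) {i n : ℕ} (hi : i ≤ n) (ω : Ω) :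
    creationTime W i ω = ∑ j ∈ Finset.range i, if j < n then W j ω else 0 := by
  refine Finset.sum_congr rfl fun j hj => ?_
  rw [if_pos ((Finset.mem_range.1 hj).trans_le hi)]

variable {Ω : Type*} [MeasurableSpace Ω] {P : Measure Ω}
  {β : ℝ} {W : ℕ → Ω → ℝ}

theorem measurable_creationTime (hW : ∀ i, Measurable (W i)) (i : ℕ) :
    Measurable (creationTime W i) :=
  Finset.measurable_fun_sum _ fun j _ => hW j

/-- Padding the past waiting times with zeros lets functionals of the first `n` of them be written
on the whole sequence space. -/
theorem indepFun_of_past (hW : ∀ i, Measurable (W i)) (hind : iIndepFun W P) {n : ℕ}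
    {α : Type*} [MeasurableSpace α] {Y : Ω → α} {Φ : (ℕ → ℝ) → α} (hΦ : Measurable Φ)
    (hY : ∀ ω, Y ω = Φ fun j => if j < n then W j ω else 0) : IndepFun Y (W n) P := by
  have h := hind.indepFun_finset (Finset.range n) {n} (by simp) hW
  have h2 := h.comp
    (φ := fun w => Φ fun j => if hj : j < n then w ⟨j, Finset.mem_range.2 hj⟩ else 0)
    (ψ := fun w : ({n} : Finset ℕ) → ℝ => w ⟨n, Finset.mem_singleton_self n⟩)
    (hΦ.comp (measurable_pi_lambda _ fun j => by split_ifs <;> fun_prop)) 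
    (measurable_pi_apply (X := fun _ : ({n} : Finset ℕ) => ℝ) ⟨n, Finset.mem_singleton_self n⟩)
  convert h2 using 1
  · ext ω
    rw [hY]
    rfl
  · rfl

/-- The sum of `g` over the creation times of the pages `1, …, n`. -/
noncomputable def creationSum (W : ℕ → Ω → ℝ) (g : ℝ → ℝ) (n : ℕ) (ω : Ω) : ℝ≥0∞ :=
  ∑ i ∈ Finset.Icc 1 n, ENNReal.ofReal (g (creationTime W i ω))

theorem measurable_creationSum (hW : ∀ i, Measurable (W i)) {g : ℝ → ℝ} (hg : Continuous g)
    (n : ℕ) : Measurable (creationSum W g n) :=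
  Finset.measurable_fun_sum _ fun i _ =>
    (hg.measurable.comp (measurable_creationTime hW i)).ennreal_ofReal

theorem indepFun_creationSum (hW : ∀ i, Measurable (W i)) (hind : iIndepFun W P)
    {g : ℝ → ℝ} (hg : Continuous g) (n : ℕ) :
    IndepFun (fun ω => (creationSum W g n ω, creationTime W n ω)) (W n) P := by
  have hm := hg.measurable
  refine indepFun_of_past hW hind (Φ := fun w =>
    (∑ i ∈ Finset.Icc 1 n, ENNReal.ofReal (g (∑ j ∈ Finset.range i, w j)),
      ∑ j ∈ Finset.range n, w j)) (by fun_prop) fun ω => ?_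
  rw [creationTime_eq_of_past W le_rfl, creationSum]
  congr 1
  refine Finset.sum_congr rfl fun i hi => ?_
  rw [creationTime_eq_of_past W (Finset.mem_Icc.1 hi).2]

variable [IsProbabilityMeasure P]

/-- The law of the creation time of page `n + 1`. -/
theorem lintegral_creationTime (hβ : 0 < β) (hW : ∀ i, Measurable (W i))
    (hlaw : ∀ i, HasLaw (W i) (expMeasure (((i : ℝ) + 1) * β)) P) (hind : iIndepFun W P) (n : ℕ)
    {ψ : ℝ → ℝ≥0∞} (hψ : Measurable ψ) :
    ∫⁻ ω, ψ (creationTime W (n + 1) ω) ∂P = ∫⁻ s in Set.Ioi 0,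
      ENNReal.ofReal (((n : ℝ) + 1) * β * Real.exp (-(((n : ℝ) + 1) * β * s)) *
        (Real.exp (β * s) - 1) ^ n) * ψ s := by
  induction n generalizing ψ with
  | zero =>
    have h := (hlaw 0).lintegral_comp (f := ψ) hψ.aemeasurable
    simp only [Nat.cast_zero, zero_add, one_mul] at h
    rw [lintegral_expMeasure _ hψ] at h
    simpa [creationTime] using h
  | succ n ih =>
    have hc : 0 < ((n + 1 : ℕ) + 1 : ℝ) * β := by positivity
    have h := lintegral_add_wait_density (Z := fun _ => 1) (T := creationTime W (n + 1))
      (V := W (n + 1)) measurable_const (measurable_creationTime hW _) (hW _) hc (hlaw (n + 1))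
      (indepFun_of_past hW hind (Φ := fun w => (1, ∑ j ∈ Finset.range (n + 1), w j))
        (by fun_prop) fun ω => by rw [creationTime_eq_of_past W le_rfl])
      -- The induction hypothesis, rewritten relative to the next rate `(n + 2)β`, has density
      -- `e^(-(n+2)βs)` times the derivative of this function.
      (F := fun s => (Real.exp (β * s) - 1) ^ (n + 1))
      (f := fun s => ((n + 1 : ℕ) : ℝ) * (Real.exp (β * s) - 1) ^ n * (Real.exp (β * s) * β))
      (by simp)
      (fun s => by
        have := ((((hasDerivAt_id s).const_mul β).exp.sub_const 1).fun_pow (n + 1))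
        simpa using this)
      (by fun_prop)
      (fun s hs => by
        have : 0 ≤ Real.exp (β * s) - 1 := sub_nonneg.2 (Real.one_le_exp (by positivity))
        positivity)
      (fun ψ hψ => by
        simp only [one_mul]
        rw [ih hψ]
        refine setLIntegral_congr_fun measurableSet_Ioi fun s _ => ?_
        have h1 : Real.exp (-(((n : ℝ) + 1) * β * s)) =
            Real.exp (-(((n + 1 : ℕ) + 1 : ℝ) * β * s)) * Real.exp (β * s) := by
          rw [← Real.exp_add]
          congr 1
          push_cast
          ring
        rw [h1]
        congr 2
        push_cast
        ring) hψ
    simp only [one_mul] at h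
    simp_rw [creationTime_succ W (n + 1)]
    exact h

/-- The primitive `s ↦ ∫₀ˢ g(u) β e^(βu) du`. -/
noncomputable def expPrimitive (β : ℝ) (g : ℝ → ℝ) (s : ℝ) : ℝ :=
  ∫ u in (0 : ℝ)..s, g u * (β * Real.exp (β * u))

theorem hasDerivAt_expPrimitive {g : ℝ → ℝ} (hg : Continuous g) (s : ℝ) :
    HasDerivAt (expPrimitive β g) (g s * (β * Real.exp (β * s))) s :=
  intervalIntegral.integral_hasDerivAt_right (Continuous.intervalIntegrable (by fun_prop) _ _)
    (Continuous.stronglyMeasurableAtFilter (by fun_prop) _ _) (by fun_prop)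

theorem expPrimitive_nonneg (hβ : 0 < β) {g : ℝ → ℝ} (hg0 : ∀ s, 0 ≤ g s) {s : ℝ} (hs : 0 ≤ s) :
    0 ≤ expPrimitive β g s :=
  intervalIntegral.integral_nonneg hs fun u _ => by
    have := hg0 u
    positivity

/-- The derivative of `s ↦ (n + 1) (e^(βs) - 1) ^ n * expPrimitive β g s`. -/
noncomputable def weightedDeriv (β : ℝ) (g : ℝ → ℝ) (n : ℕ) (s : ℝ) : ℝ :=
  (n + 1) * (n * (Real.exp (β * s) - 1) ^ (n - 1) * (Real.exp (β * s) * β)) * expPrimitive β g s +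
    (n + 1) * (Real.exp (β * s) - 1) ^ n * (g s * (β * Real.exp (β * s)))

theorem hasDerivAt_weighted {g : ℝ → ℝ} (hg : Continuous g) (n : ℕ) (s : ℝ) :
    HasDerivAt (fun s => (n + 1) * (Real.exp (β * s) - 1) ^ n * expPrimitive β g s)
      (weightedDeriv β g n s) s := by
  have h1 := ((((hasDerivAt_id s).const_mul β).exp.sub_const 1).fun_pow n).const_mul ((n : ℝ) + 1)
  have h2 := h1.fun_mul (hasDerivAt_expPrimitive (β := β) hg s)
  simpa [weightedDeriv] using h2

theorem continuous_weightedDeriv {g : ℝ → ℝ} (hg : Continuous g) (n : ℕ) :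
    Continuous (weightedDeriv β g n) := by
  have : Continuous (expPrimitive β g) :=
    continuous_iff_continuousAt.2 fun s => (hasDerivAt_expPrimitive hg s).continuousAt
  unfold weightedDeriv
  fun_prop

theorem weightedDeriv_nonneg (hβ : 0 < β) {g : ℝ → ℝ} (hg0 : ∀ s, 0 ≤ g s) (n : ℕ) {s : ℝ}
    (hs : 0 ≤ s) : 0 ≤ weightedDeriv β g n s := by
  have h1 : 0 ≤ Real.exp (β * s) - 1 := sub_nonneg.2 (Real.one_le_exp (by positivity))
  have h2 := expPrimitive_nonneg hβ hg0 hs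
  have h3 := hg0 s
  unfold weightedDeriv
  positivity

/-- Induction on the page number. Waiting for page `n + 2` carries over the sum on earlier pages by
`lintegral_add_wait_density`, and the new page contributes `g` times the density of its own creation
time. The two parts are the two terms of the product rule in `weightedDeriv`. -/
theorem lintegral_creationSum (hβ : 0 < β) (hW : ∀ i, Measurable (W i))
    (hlaw : ∀ i, HasLaw (W i) (expMeasure (((i : ℝ) + 1) * β)) P) (hind : iIndepFun W P)
    {g : ℝ → ℝ} (hg : Continuous g) (hg0 : ∀ s, 0 ≤ g s) (n : ℕ)
    {ψ : ℝ → ℝ≥0∞} (hψ : Measurable ψ) :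
    ∫⁻ ω, creationSum W g (n + 1) ω * ψ (creationTime W (n + 1) ω) ∂P = ∫⁻ s in Set.Ioi 0,
      ENNReal.ofReal (Real.exp (-(((n + 1 : ℕ) + 1 : ℝ) * β * s)) * weightedDeriv β g n s) *
        ψ s := by
  have hgm := hg.measurable
  induction n generalizing ψ with
  | zero =>
    have h := lintegral_creationTime hβ hW hlaw hind 0 (ψ := fun s => ENNReal.ofReal (g s) * ψ s)
      (by fun_prop)
    simp only [creationSum, zero_add, Finset.Icc_self, Finset.sum_singleton] at h ⊢
    rw [h]
    refine setLIntegral_congr_fun measurableSet_Ioi fun s _ => ?_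
    have h1 : Real.exp (-(β * s)) = Real.exp (-((1 + 1) * β * s)) * Real.exp (β * s) := by
      rw [← Real.exp_add]
      congr 1
      ring
    simp only [Nat.cast_zero, zero_add, one_mul, pow_zero, mul_one, weightedDeriv, zero_mul,
      mul_zero, Nat.cast_one]
    rw [← mul_assoc, ← ENNReal.ofReal_mul (by positivity), h1]
    congr 2
    ring
  | succ n ih =>
    have hc : 0 < ((n + 1 : ℕ) + 1 : ℝ) * β := by positivity
    have h := lintegral_add_wait_density (measurable_creationSum hW hg (n + 1))
      (measurable_creationTime hW (n + 1)) (hW (n + 1)) hc (hlaw (n + 1))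
      (indepFun_creationSum hW hind hg (n + 1))
      (F := fun s => (n + 1) * (Real.exp (β * s) - 1) ^ n * expPrimitive β g s)
      (f := weightedDeriv β g n) (by simp [expPrimitive]) (hasDerivAt_weighted hg n)
      (continuous_weightedDeriv hg n) (fun s hs => weightedDeriv_nonneg hβ hg0 n hs)
      (fun ψ hψ => ih hψ) hψ
    have h2 := lintegral_creationTime hβ hW hlaw hind (n + 1)
      (ψ := fun s => ENNReal.ofReal (g s) * ψ s) (by fun_prop)
    have h3 : ∀ ω, creationSum W g (n + 1 + 1) ω * ψ (creationTime W (n + 1 + 1) ω) =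
        creationSum W g (n + 1) ω * ψ (creationTime W (n + 1) ω + W (n + 1) ω) +
          ENNReal.ofReal (g (creationTime W (n + 1 + 1) ω)) *
            ψ (creationTime W (n + 1 + 1) ω) := fun ω => by
      rw [creationSum, Finset.sum_Icc_succ_top (by omega), add_mul, ← creationTime_succ]
      rfl
    have hmT := measurable_creationTime hW (n + 1)
    have hmS := measurable_creationSum hW hg (n + 1)
    have hmW := hW (n + 1)
    have hmE : Measurable (expPrimitive β g) := Continuous.measurable
      (continuous_iff_continuousAt.2 fun s => (hasDerivAt_expPrimitive hg s).continuousAt)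
    simp_rw [h3]
    rw [lintegral_add_left (by fun_prop), h, h2, ← lintegral_add_left (by fun_prop)]
    refine setLIntegral_congr_fun measurableSet_Ioi fun s hs => ?_
    have hs0 : 0 ≤ s := le_of_lt hs
    have e1 : 0 ≤ Real.exp (β * s) - 1 := sub_nonneg.2 (Real.one_le_exp (by positivity))
    have e2 := expPrimitive_nonneg hβ hg0 hs0
    have e3 := hg0 s
    rw [← mul_assoc _ (ENNReal.ofReal (g s)), ← ENNReal.ofReal_mul (by positivity), ← add_mul,
      ← ENNReal.ofReal_add (by positivity) (by positivity)]
    have h1 : Real.exp (-(((n + 1 : ℕ) + 1 : ℝ) * β * s)) =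
        Real.exp (-(((n + 1 + 1 : ℕ) + 1 : ℝ) * β * s)) * Real.exp (β * s) := by
      rw [← Real.exp_add]
      congr 1
      push_cast
      ring
    rw [h1, weightedDeriv]
    congr 2
    push_cast
    ring

theorem lintegral_creationSum_between (hβ : 0 < β) (hW : ∀ i, Measurable (W i))
    (hlaw : ∀ i, HasLaw (W i) (expMeasure (((i : ℝ) + 1) * β)) P) (hind : iIndepFun W P)
    {g : ℝ → ℝ} (hg : Continuous g) (hg0 : ∀ s, 0 ≤ g s) (n : ℕ) {t : ℝ} (ht : 0 ≤ t) :
    ∫⁻ ω in {ω | creationTime W (n + 1) ω ≤ t ∧ t < creationTime W (n + 2) ω},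
      creationSum W g (n + 1) ω ∂P =
      ENNReal.ofReal (((n : ℝ) + 1) * (1 - Real.exp (-(β * t))) ^ n *
        (Real.exp (-(β * t)) ^ 2 * expPrimitive β g t)) := by
  have hc : 0 < ((n + 1 : ℕ) + 1 : ℝ) * β := by positivity
  have h := lintegral_between (measurable_creationSum hW hg (n + 1))
      (measurable_creationTime hW (n + 1)) (hW (n + 1)) hc (hlaw (n + 1))
      (indepFun_creationSum hW hind hg (n + 1))
      (F := fun s => (n + 1) * (Real.exp (β * s) - 1) ^ n * expPrimitive β g s)
      (f := weightedDeriv β g n) (by simp [expPrimitive]) (hasDerivAt_weighted hg n)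
      (continuous_weightedDeriv hg n) (fun s hs => weightedDeriv_nonneg hβ hg0 n hs)
      (fun ψ hψ => lintegral_creationSum hβ hW hlaw hind hg hg0 n hψ) ht
  simp_rw [← creationTime_succ] at h
  rw [h]
  congr 1
  have h1 : Real.exp (-(((n + 1 : ℕ) + 1 : ℝ) * β * t)) = Real.exp (-(β * t)) ^ (n + 2) := by
    rw [← Real.exp_nat_mul]
    congr 1
    push_cast
    ring
  have h2 : 1 - Real.exp (-(β * t)) = Real.exp (-(β * t)) * (Real.exp (β * t) - 1) := by
    rw [mul_sub, ← Real.exp_add]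
    simp
  rw [h1, h2, mul_pow]
  ring

/-- Substituting age `s = t - u` for creation time `u` turns the growing weight `e^(βu)` into the
decaying density of the age. -/
theorem exp_mul_expPrimitive (hβ : 0 < β) {f : ℝ → ℝ} (hf : Continuous f) (hf0 : ∀ s, 0 ≤ f s)
    {t : ℝ} (ht : 0 ≤ t) :
    ENNReal.ofReal (Real.exp (-(β * t)) * expPrimitive β (fun u => f (t - u)) t) =
      ∫⁻ s in Set.Ioc 0 t, ENNReal.ofReal (β * Real.exp (-(β * s))) * ENNReal.ofReal (f s) := by
  have h1 : Real.exp (-(β * t)) * expPrimitive β (fun u => f (t - u)) t =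
      ∫ s in Set.Ioc 0 t, β * Real.exp (-(β * s)) * f s := by
    have h := intervalIntegral.integral_comp_sub_left (a := 0) (b := t)
      (fun s => β * Real.exp (-(β * s)) * f s) t
    rw [sub_self, sub_zero] at h
    rw [← intervalIntegral.integral_of_le ht, ← h, expPrimitive,
      ← intervalIntegral.integral_const_mul]
    refine intervalIntegral.integral_congr fun u _ => ?_
    rw [show -(β * (t - u)) = -(β * t) + β * u by ring, Real.exp_add]
    ring
  rw [h1, ofReal_integral_eq_lintegral_ofReal]
  · exact lintegral_congr fun s => ENNReal.ofReal_mul (by positivity)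
  · exact (Continuous.integrableOn_Icc (by fun_prop)).mono_set Set.Ioc_subset_Icc_self
  · exact ae_of_all _ fun s => mul_nonneg (by positivity) (hf0 s)

/-- Averaging over the pages created up to time `t`: the age of a uniformly drawn page has the
density `β e^(-βs)` on `(0, t]`. -/
theorem tsum_lintegral_creationSum (hβ : 0 < β) (hW : ∀ i, Measurable (W i))
    (hlaw : ∀ i, HasLaw (W i) (expMeasure (((i : ℝ) + 1) * β)) P) (hind : iIndepFun W P)
    {f : ℝ → ℝ} (hf : Continuous f) (hf0 : ∀ s, 0 ≤ f s) {t : ℝ} (ht : 0 ≤ t) :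
    ∑' n : ℕ, ENNReal.ofReal (1 / ((n : ℝ) + 1)) *
      ∫⁻ ω in {ω | creationTime W (n + 1) ω ≤ t ∧ t < creationTime W (n + 2) ω},
        creationSum W (fun u => f (t - u)) (n + 1) ω ∂P =
      ∫⁻ s in Set.Ioc 0 t, ENNReal.ofReal (β * Real.exp (-(β * s))) * ENNReal.ofReal (f s) := by
  have hfc : Continuous fun u => f (t - u) := by fun_prop
  have hG := expPrimitive_nonneg hβ (fun u => hf0 (t - u)) ht
  have hq1 : Real.exp (-(β * t)) ≤ 1 := Real.exp_le_one_iff.2 (by nlinarith)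
  have hq0 := Real.exp_pos (-(β * t))
  have hterm : ∀ n : ℕ, ENNReal.ofReal (1 / ((n : ℝ) + 1)) *
      ∫⁻ ω in {ω | creationTime W (n + 1) ω ≤ t ∧ t < creationTime W (n + 2) ω},
        creationSum W (fun u => f (t - u)) (n + 1) ω ∂P =
      ENNReal.ofReal ((1 - Real.exp (-(β * t))) ^ n *
        (Real.exp (-(β * t)) ^ 2 * expPrimitive β (fun u => f (t - u)) t)) := fun n => by
    rw [lintegral_creationSum_between hβ hW hlaw hind hfc (fun s => hf0 _) n ht,
      ← ENNReal.ofReal_mul (by positivity)]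
    congr 1
    field_simp
  simp_rw [hterm]
  -- The ratio is `1 - e^(-βt)`, so the sum contributes `e^(βt)` and leaves a single factor
  -- `e^(-βt)`.
  have hsum := (hasSum_geometric_of_lt_one (sub_nonneg.2 hq1)
    (sub_lt_self 1 hq0)).mul_right (Real.exp (-(β * t)) ^ 2 * expPrimitive β (fun u => f (t - u)) t)
  rw [← ENNReal.ofReal_tsum_of_nonneg (fun n => ?_) hsum.summable, hsum.tsum_eq,
    ← exp_mul_expPrimitive hβ hf hf0 ht]
  · congr 1
    rw [sub_sub_cancel]
    field_simp
  · have := sub_nonneg.2 hq1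
    positivity

end Yule

/-! ### Right-continuous processes at independent random times -/

section RandomTime

/-- A countably valued approximation of a time from the right, with step `1 / (k + 1)`. -/
noncomputable def rightApprox (k : ℕ) (x : ℝ≥0) : ℝ≥0 :=
  ((⌊x * ((k : ℝ≥0) + 1)⌋₊ : ℝ≥0) + 1) / ((k : ℝ≥0) + 1)

theorem le_rightApprox (k : ℕ) (x : ℝ≥0) : x ≤ rightApprox k x := by
  rw [rightApprox, le_div_iff₀ (by positivity)]
  exact (Nat.lt_floor_add_one _).le

theorem tendsto_rightApprox (x : ℝ≥0) : Tendsto (fun k => rightApprox k x) atTop (𝓝[≥] x) := by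
  refine tendsto_nhdsWithin_iff.2 ⟨?_, Eventually.of_forall fun k => le_rightApprox k x⟩
  have h1 : Tendsto (fun k : ℕ => x + 1 / ((k : ℝ≥0) + 1)) atTop (𝓝 x) := by
    simpa using (tendsto_const_nhds (x := x)).add (tendsto_one_div_add_atTop_nhds_zero_nat
      (𝕜 := ℝ≥0))
  refine tendsto_of_tendsto_of_tendsto_of_le_of_le tendsto_const_nhds h1
    (fun k => le_rightApprox k x) fun k => ?_
  simp only [rightApprox]
  rw [div_le_iff₀ (by positivity), add_mul, one_div_mul_cancel (by positivity)]
  gcongr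
  exact Nat.floor_le (by positivity)

theorem tendsto_indicator_rightApprox {Ω : Type*} {X : ℝ≥0 → Ω → ℕ} {ω : Ω}
    (hr : ∀ t, ContinuousWithinAt (fun s => X s ω) (Set.Ici t) t) (A : Set ℕ) (x : ℝ≥0) :
    Tendsto (fun k => A.indicator (1 : ℕ → ℝ≥0∞) (X (rightApprox k x) ω)) atTop
      (𝓝 (A.indicator 1 (X x ω))) :=
  (continuous_of_discreteTopology.tendsto _).comp ((hr x).tendsto.comp (tendsto_rightApprox x))

variable {Ω : Type*} [MeasurableSpace Ω] {P : Measure Ω}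

/-- The joint law factorizes in two stages, first `U` from `(V, X)` and then `V` from `X`;
reassociating the product of the three laws gives the claim. -/
theorem indepFun_prodMk_of_indepFun [IsProbabilityMeasure P] {α γ δ : Type*} [MeasurableSpace α] [MeasurableSpace γ]
    [MeasurableSpace δ] {U : Ω → α} {V : Ω → γ} {X : Ω → δ} (hU : Measurable U)
    (hV : Measurable V) (hX : Measurable X) (h1 : IndepFun U (fun ω => (V ω, X ω)) P)
    (h2 : IndepFun V X P) : IndepFun (fun ω => (U ω, V ω)) X P := by
  have h3 : IndepFun U V P := h1.comp (φ := id) (ψ := Prod.fst) measurable_id measurable_fst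
  rw [indepFun_iff_map_prod_eq_prod_map_map (by fun_prop) (by fun_prop)] at h1 h2 h3 ⊢
  have := Measure.isProbabilityMeasure_map (μ := P) hU.aemeasurable
  have := Measure.isProbabilityMeasure_map (μ := P) hV.aemeasurable
  have := Measure.isProbabilityMeasure_map (μ := P) hX.aemeasurable
  have h4 : (fun ω => ((U ω, V ω), X ω)) =
      MeasurableEquiv.prodAssoc.symm ∘ fun ω => (U ω, (V ω, X ω)) := rfl
  rw [h4, ← Measure.map_map (MeasurableEquiv.measurable _) (by fun_prop), h1, h2, h3]
  exact (measurePreserving_prodAssoc _ _ _).symm.map_eq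

variable {α : Type*} [MeasurableSpace α] {Y : Ω → α} {X : ℝ≥0 → Ω → ℕ}

/-- On each level set of `κ ∘ Y` the time is constant, so independence at fixed times suffices. -/
theorem setLIntegral_countable_time (hY : Measurable Y) (hX : ∀ s, Measurable (X s))
    (hind : ∀ s, IndepFun Y (X s) P) {κ : α → ℕ} (hκ : Measurable κ) (s : ℕ → ℝ≥0)
    {B : Set α} (hB : MeasurableSet B) (A : Set ℕ) :
    ∫⁻ ω in Y ⁻¹' B, A.indicator 1 (X (s (κ (Y ω))) ω) ∂P =
      ∫⁻ ω in Y ⁻¹' B, P {ω' | X (s (κ (Y ω))) ω' ∈ A} ∂P := by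
  have hBj : ∀ j, MeasurableSet (B ∩ κ ⁻¹' {j}) := fun j =>
    hB.inter (hκ (measurableSet_singleton j))
  have hU : Y ⁻¹' B = ⋃ j, Y ⁻¹' (B ∩ κ ⁻¹' {j}) := by
    ext ω
    simp
  have hd : Pairwise (Function.onFun Disjoint fun j => Y ⁻¹' (B ∩ κ ⁻¹' {j})) := by
    intro i j hij
    refine Set.disjoint_left.2 fun ω h1 h2 => hij ?_
    exact h1.2.symm.trans h2.2
  rw [hU, lintegral_iUnion (fun j => hY (hBj j)) hd, lintegral_iUnion (fun j => hY (hBj j)) hd]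
  refine tsum_congr fun j => ?_
  have e1 : ∫⁻ ω in Y ⁻¹' (B ∩ κ ⁻¹' {j}), A.indicator 1 (X (s (κ (Y ω))) ω) ∂P =
      ∫⁻ ω in Y ⁻¹' (B ∩ κ ⁻¹' {j}), (X (s j) ⁻¹' A).indicator 1 ω ∂P := by
    refine setLIntegral_congr_fun (hY (hBj j)) fun ω hω => ?_
    have : κ (Y ω) = j := hω.2
    rw [this]
    rfl
  have e2 : ∫⁻ ω in Y ⁻¹' (B ∩ κ ⁻¹' {j}), P {ω' | X (s (κ (Y ω))) ω' ∈ A} ∂P =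
      ∫⁻ ω in Y ⁻¹' (B ∩ κ ⁻¹' {j}), P (X (s j) ⁻¹' A) ∂P := by
    refine setLIntegral_congr_fun (hY (hBj j)) fun ω hω => ?_
    have : κ (Y ω) = j := hω.2
    simp only [this]
    rfl
  rw [e1, e2, setLIntegral_const, lintegral_indicator_one (hX _ (MeasurableSet.of_discrete)),
    Measure.restrict_apply (hX _ (MeasurableSet.of_discrete)), Set.inter_comm,
    (hind (s j)).measure_inter_preimage_eq_mul _ _ (hBj j) MeasurableSet.of_discrete, mul_comm]

theorem measurable_rightApprox_comp {Y : Ω → ℝ≥0} (hY : Measurable Y)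
    (hX : ∀ s, Measurable (X s)) (A : Set ℕ) (k : ℕ) :
    Measurable fun ω => A.indicator (1 : ℕ → ℝ≥0∞) (X (rightApprox k (Y ω)) ω) := by
  refine (measurable_of_countable (A.indicator (1 : ℕ → ℝ≥0∞))).comp ?_
  have h1 : Measurable fun p : ℕ × Ω => X (((p.1 : ℝ≥0) + 1) / ((k : ℝ≥0) + 1)) p.2 :=
    measurable_from_prod_countable_right fun n => hX (((n : ℝ≥0) + 1) / ((k : ℝ≥0) + 1))
  exact h1.comp (f := fun ω => (⌊Y ω * ((k : ℝ≥0) + 1)⌋₊, ω))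
    ((Nat.measurable_floor.comp (hY.mul_const _)).prodMk measurable_id)

theorem measurable_indicator_time {Y : Ω → ℝ≥0} (hY : Measurable Y)
    (hX : ∀ s, Measurable (X s))
    (hr : ∀ ω t, ContinuousWithinAt (fun s => X s ω) (Set.Ici t) t) (A : Set ℕ) :
    Measurable fun ω => A.indicator (1 : ℕ → ℝ≥0∞) (X (Y ω) ω) :=
  ENNReal.measurable_of_tendsto (f := fun k ω => A.indicator 1 (X (rightApprox k (Y ω)) ω))
    (fun k => measurable_rightApprox_comp hY hX A k)
    (tendsto_pi_nhds.2 fun ω => tendsto_indicator_rightApprox (hr ω) A (Y ω))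

theorem measurableSet_time {Y : Ω → ℝ≥0} (hY : Measurable Y)
    (hX : ∀ s, Measurable (X s))
    (hr : ∀ ω t, ContinuousWithinAt (fun s => X s ω) (Set.Ici t) t) (A : Set ℕ) :
    MeasurableSet {ω | X (Y ω) ω ∈ A} := by
  have h := measurable_indicator_time hY hX hr A (measurableSet_singleton 1)
  convert h using 1
  ext ω
  by_cases hω : X (Y ω) ω ∈ A <;> simp [hω]

/-- A right-continuous process evaluated at a random time independent of it. -/
theorem setLIntegral_independent_time [IsProbabilityMeasure P] (hY : Measurable Y) (hX : ∀ s, Measurable (X s))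
    (hr : ∀ ω t, ContinuousWithinAt (fun s => X s ω) (Set.Ici t) t)
    (hind : ∀ s, IndepFun Y (X s) P) {θ : α → ℝ≥0} (hθ : Measurable θ)
    {B : Set α} (hB : MeasurableSet B) {A : Set ℕ}
    (hp : Continuous fun s => P {ω | X s ω ∈ A}) :
    P (Y ⁻¹' B ∩ {ω | X (θ (Y ω)) ω ∈ A}) =
      ∫⁻ ω in Y ⁻¹' B, P {ω' | X (θ (Y ω)) ω' ∈ A} ∂P := by
  have hm : MeasurableSet {ω | X (θ (Y ω)) ω ∈ A} := measurableSet_time (hθ.comp hY) hX hr A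
  have h1 : ∫⁻ ω in Y ⁻¹' B, A.indicator 1 (X (θ (Y ω)) ω) ∂P =
      P (Y ⁻¹' B ∩ {ω | X (θ (Y ω)) ω ∈ A}) := by
    rw [Set.inter_comm, ← Measure.restrict_apply hm, ← lintegral_indicator_one hm]
    refine lintegral_congr fun ω => ?_
    by_cases hω : X (θ (Y ω)) ω ∈ A <;> simp [hω]
  have hk : ∀ k, ∫⁻ ω in Y ⁻¹' B, A.indicator 1 (X (rightApprox k (θ (Y ω))) ω) ∂P =
      ∫⁻ ω in Y ⁻¹' B, P {ω' | X (rightApprox k (θ (Y ω))) ω' ∈ A} ∂P := fun k =>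
    setLIntegral_countable_time hY hX hind
      (κ := fun y => ⌊θ y * ((k : ℝ≥0) + 1)⌋₊) (Nat.measurable_floor.comp (hθ.mul_const _))
      (fun j => ((j : ℝ≥0) + 1) / ((k : ℝ≥0) + 1)) hB A
  -- Approximation from the right uses right-continuity of the paths on this side and continuity of
  -- the fixed-time probabilities on the other.
  have ha : Tendsto (fun k => ∫⁻ ω in Y ⁻¹' B, A.indicator 1 (X (rightApprox k (θ (Y ω))) ω) ∂P)
      atTop (𝓝 (∫⁻ ω in Y ⁻¹' B, A.indicator 1 (X (θ (Y ω)) ω) ∂P)) := by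
    refine tendsto_lintegral_of_dominated_convergence 1
      (fun k => measurable_rightApprox_comp (hθ.comp hY) hX A k)
      (fun k => ae_of_all _ fun ω => Set.indicator_le_self' (fun _ _ => zero_le) _) (by simp)
      (ae_of_all _ fun ω => tendsto_indicator_rightApprox (hr ω) A _)
  have hb : Tendsto (fun k => ∫⁻ ω in Y ⁻¹' B, P {ω' | X (rightApprox k (θ (Y ω))) ω' ∈ A} ∂P)
      atTop (𝓝 (∫⁻ ω in Y ⁻¹' B, P {ω' | X (θ (Y ω)) ω' ∈ A} ∂P)) := by
    refine tendsto_lintegral_of_dominated_convergence 1 (fun k => ?_)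
      (fun k => ae_of_all _ fun ω => prob_le_one) (by simp)
      (ae_of_all _ fun ω => (hp.tendsto _).comp
        ((tendsto_rightApprox _).mono_right nhdsWithin_le_nhds))
    have h2 := hp.measurable
    have h3 : Measurable (rightApprox k) := by
      unfold rightApprox
      exact ((measurable_of_countable (fun n : ℕ => (n : ℝ≥0))).comp
        (Nat.measurable_floor.comp (measurable_id.mul_const _))).add_const 1 |>.div_const _
    exact h2.comp (h3.comp (hθ.comp hY))
  simp_rw [hk] at ha
  rw [← h1]
  exact tendsto_nhds_unique ha hb

end RandomTime

/-! ### The number of new pages in terms of creation times -/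

section Count

variable {Ω : Type*} {W : ℕ → Ω → ℝ}

theorem strictMono_creationTime {ω : Ω} (hω : ∀ i, 0 < W i ω) :
    StrictMono fun i => creationTime W i ω :=
  strictMono_nat_of_lt_succ fun i => by
    rw [creationTime_succ]
    linarith [hω i]

theorem newPageCount_eq_of_between {ω : Ω} (hω : ∀ i, 0 < W i ω) {t : ℝ} {m : ℕ}
    (h1 : creationTime W m ω ≤ t) (h2 : t < creationTime W (m + 1) ω) :
    newPageCount W t ω = m := by
  have hmono := strictMono_creationTime hω
  have : {i : ℕ | 1 ≤ i ∧ creationTime W i ω ≤ t} = (Finset.Icc 1 m : Set ℕ) := by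
    ext i
    simp only [Set.mem_ofPred_eq, Finset.coe_Icc, Set.mem_Icc, and_congr_right_iff]
    refine fun _ => ⟨fun hi => ?_, fun hi => (hmono.monotone hi).trans h1⟩
    by_contra! h
    exact absurd (h2.trans_le (hmono.monotone (Nat.succ_le_of_lt h))) (not_lt.2 hi)
  rw [newPageCount, this, Set.ncard_coe_finset]
  simp

theorem newPageCount_eq_succ_iff {ω : Ω} (hω : ∀ i, 0 < W i ω) {t : ℝ} (ht : 0 ≤ t) (n : ℕ) :
    newPageCount W t ω = n + 1 ↔
      creationTime W (n + 1) ω ≤ t ∧ t < creationTime W (n + 2) ω := by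
  refine ⟨fun h => ?_, fun h => newPageCount_eq_of_between hω h.1 h.2⟩
  -- `Set.ncard` of an infinite set is `0`, so a positive count already rules out infinitely many
  -- creations by time `t`.
  have hfin : {i : ℕ | 1 ≤ i ∧ creationTime W i ω ≤ t}.Finite :=
    Set.finite_of_ncard_ne_zero (by change newPageCount W t ω ≠ 0; omega)
  have hex : ∃ m, t < creationTime W (m + 1) ω := by
    by_contra! hall
    refine Set.infinite_of_injective_forall_mem (f := fun m : ℕ => m + 1)
      (add_left_injective 1) (fun m => ?_) hfin
    exact ⟨by omega, hall m⟩
  classical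
  have h2 := Nat.find_spec hex
  have h1 : creationTime W (Nat.find hex) ω ≤ t := by
    rcases Nat.eq_zero_or_pos (Nat.find hex) with h0 | h0
    · rw [h0]
      simpa [creationTime] using ht
    · have := Nat.find_min hex (Nat.sub_one_lt h0.ne')
      rw [Nat.sub_add_cancel h0] at this
      exact not_lt.1 this
  have h3 := newPageCount_eq_of_between hω h1 h2
  rw [h] at h3
  rw [← h3] at h1 h2
  exact ⟨h1, h2⟩

end Count

/-! ### The law of the number of in-links of the drawn page -/

section Draw

variable {Ω : Type*} [MeasurableSpace Ω] {P : Measure Ω}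
  {ν β : ℝ} {rate : ℕ → ℝ} {W : ℕ → Ω → ℝ} {X : ℕ → ℝ≥0 → Ω → ℕ} {U : Ω → ℝ}

theorem IsModel.ae_wait_pos (hM : IsModel P ν β rate W X U) : ∀ᵐ ω ∂P, ∀ i, 0 < W i ω := by
  refine ae_all_iff.2 fun i => ?_
  have h := (hM.law_wait i).lintegral_comp (f := (Set.Iic (0 : ℝ)).indicator 1)
    (measurable_one.indicator measurableSet_Iic).aemeasurable
  rw [lintegral_expMeasure _ (measurable_one.indicator measurableSet_Iic)] at h
  have h2 : ∫⁻ ω, (Set.Iic (0 : ℝ)).indicator (1 : ℝ → ℝ≥0∞) (W i ω) ∂P = 0 := by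
    rw [h]
    refine (setLIntegral_congr_fun measurableSet_Ioi fun x hx => ?_).trans lintegral_zero
    rw [Set.indicator_of_notMem (by simpa using hx), mul_zero]
  have hm : Measurable fun ω => (Set.Iic (0 : ℝ)).indicator (1 : ℝ → ℝ≥0∞) (W i ω) :=
    (measurable_one.indicator measurableSet_Iic).comp (hM.measurable_wait i)
  rw [lintegral_eq_zero_iff hm] at h2
  filter_upwards [h2] with ω hω
  by_contra! hneg
  simp [hneg] at hω

/-- Excludes the null event `U = 1`, where `drawnPage` would overshoot the last new page by one. -/
theorem IsModel.ae_draw_mem (hM : IsModel P ν β rate W X U) : ∀ᵐ ω ∂P, 0 ≤ U ω ∧ U ω < 1 := by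
  refine (hM.law_draw.ae_iff (p := fun u => 0 ≤ u ∧ u < 1) ?_).2 ?_
  · exact measurableSet_setOfPred.1 measurableSet_Ico
  · have : ∀ᵐ u : ℝ, u ≠ 1 := by simp [ae_iff, measure_singleton]
    filter_upwards [ae_restrict_mem measurableSet_Icc, ae_restrict_of_ae this] with u hu hne
    exact ⟨hu.1, lt_of_le_of_ne hu.2 hne⟩

theorem IsModel.prob_draw (hM : IsModel P ν β rate W X U) {n i : ℕ} (hi : i ≤ n) :
    P {ω | ⌊U ω * ((n : ℝ) + 1)⌋₊ = i} = ENNReal.ofReal (1 / ((n : ℝ) + 1)) := by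
  have hm : MeasurableSet {u : ℝ | ⌊u * ((n : ℝ) + 1)⌋₊ = i} :=
    (Nat.measurable_floor.comp (measurable_id.mul_const _)) (measurableSet_singleton i)
  have hn : (0 : ℝ) < (n : ℝ) + 1 := by positivity
  rw [hM.law_draw.measure_eq (p := fun u => ⌊u * ((n : ℝ) + 1)⌋₊ = i) hm,
    Measure.restrict_apply hm]
  have hset : {u : ℝ | ⌊u * ((n : ℝ) + 1)⌋₊ = i} ∩ Set.Icc 0 1 =
      Set.Ico ((i : ℝ) / (n + 1)) ((i + 1) / (n + 1)) ∩ Set.Iic 1 := by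
    ext u
    simp only [Set.mem_inter_iff, Set.mem_ofPred_eq, Set.mem_Icc, Set.mem_Ico, Set.mem_Iic]
    rw [div_le_iff₀ hn, lt_div_iff₀ hn, ← and_assoc, and_congr_left_iff]
    intro _
    constructor
    · rintro ⟨h1, h2⟩
      exact (Nat.floor_eq_iff (by positivity)).1 h1
    · rintro ⟨h1, h2⟩
      have hu : 0 ≤ u := by
        by_contra! hneg
        have : u * ((n : ℝ) + 1) < 0 := mul_neg_of_neg_of_pos hneg hn
        linarith [(Nat.cast_nonneg i : (0 : ℝ) ≤ i)]
      exact ⟨(Nat.floor_eq_iff (by positivity)).2 ⟨h1, h2⟩, hu⟩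
  have hle : ((i : ℝ) + 1) / (n + 1) ≤ 1 := by
    rw [div_le_one hn]
    have : (i : ℝ) ≤ n := by exact_mod_cast hi
    linarith
  rw [hset, Set.inter_eq_left.2 fun u hu => hu.2.le.trans hle, Real.volume_Ico]
  congr 1
  field_simp
  ring

theorem IsModel.measurableSet_between (hM : IsModel P ν β rate W X U) (t : ℝ) (n : ℕ) :
    MeasurableSet {ω | creationTime W (n + 1) ω ≤ t ∧ t < creationTime W (n + 2) ω} :=
  (measurableSet_le (measurable_creationTime hM.measurable_wait _) measurable_const).inter
    (measurableSet_lt measurable_const (measurable_creationTime hM.measurable_wait _))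

variable [IsProbabilityMeasure P]

theorem IsModel.indep_draw_wait_birth (hM : IsModel P ν β rate W X U) (i : ℕ) (s : ℝ≥0) :
    IndepFun (fun ω => (U ω, fun j => W j ω)) (X i s) P := by
  refine indepFun_prodMk_of_indepFun hM.measurable_draw
    (measurable_pi_lambda _ hM.measurable_wait) ((hM.birth i).measurable s) ?_ ?_
  · exact hM.indep_draw.comp (φ := id)
      (ψ := fun q : (ℕ → ℝ) × (ℕ → ℝ≥0 → ℕ) => (q.1, q.2 i s)) measurable_id (by fun_prop)
  · exact hM.indep_wait_birth.comp (φ := id) (ψ := fun x : ℕ → ℝ≥0 → ℕ => x i s)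
      measurable_id (by fun_prop)

variable {A : Set ℕ} {f : ℝ → ℝ}

/-- The probability of drawing page `i + 1` out of `n + 1` new pages and finding it in `A`. -/
theorem IsModel.prob_draw_page (hM : IsModel P ν β rate W X U) (hf : Continuous f)
    (hfA : ∀ i s, P {ω | X i (Real.toNNReal s) ω ∈ A} = ENNReal.ofReal (f s)) (t : ℝ)
    {n i : ℕ} (hi : i ≤ n) :
    P (({ω | creationTime W (n + 1) ω ≤ t ∧ t < creationTime W (n + 2) ω} ∩
        {ω | ⌊U ω * ((n : ℝ) + 1)⌋₊ = i}) ∩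
        {ω | X (i + 1) (t - creationTime W (i + 1) ω).toNNReal ω ∈ A}) =
      ENNReal.ofReal (1 / ((n : ℝ) + 1)) *
        ∫⁻ ω in {ω | creationTime W (n + 1) ω ≤ t ∧ t < creationTime W (n + 2) ω},
          ENNReal.ofReal (f (t - creationTime W (i + 1) ω)) ∂P := by
  have hW := hM.measurable_wait
  have hfm := hf.measurable
  have hU := hM.measurable_draw
  have hmT := measurable_creationTime hW (i + 1)
  set C : Set Ω := {ω | creationTime W (n + 1) ω ≤ t ∧ t < creationTime W (n + 2) ω}
  have hC : MeasurableSet C := hM.measurableSet_between t n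
  have hD : MeasurableSet {u : ℝ | ⌊u * ((n : ℝ) + 1)⌋₊ = i} :=
    (Nat.measurable_floor.comp (measurable_id.mul_const _)) (measurableSet_singleton i)
  have hDU : MeasurableSet {ω | ⌊U ω * ((n : ℝ) + 1)⌋₊ = i} := hU hD
  set τ : ℕ → (ℕ → ℝ) → ℝ := fun j w => ∑ l ∈ Finset.range j, w l
  have hτ : ∀ j, Measurable (τ j) := fun j => by fun_prop
  set C' : Set (ℕ → ℝ) := {w | τ (n + 1) w ≤ t ∧ t < τ (n + 2) w}
  have hC' : MeasurableSet C' :=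
    (measurableSet_le (hτ _) measurable_const).inter (measurableSet_lt measurable_const (hτ _))
  have hB : MeasurableSet ({u : ℝ | ⌊u * ((n : ℝ) + 1)⌋₊ = i} ×ˢ C') := hD.prod hC'
  have hp : Continuous fun s => P {ω | X (i + 1) s ω ∈ A} := by
    have : (fun s => P {ω | X (i + 1) s ω ∈ A}) = fun s : ℝ≥0 => ENNReal.ofReal (f s) := by
      ext s
      rw [← hfA (i + 1), Real.toNNReal_coe]
    rw [this]
    exact ENNReal.continuous_ofReal.comp (hf.comp NNReal.continuous_coe)
  -- The age of page `i + 1` and the event of drawing it depend on `(U, W)` only, which is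
  -- independent of the in-link process of that page.
  have key := setLIntegral_independent_time (P := P) (Y := fun ω => (U ω, fun j => W j ω))
    (X := X (i + 1)) (hU.prodMk (measurable_pi_lambda _ hW)) (hM.birth _).measurable
    (hM.birth _).rightCont (hM.indep_draw_wait_birth (i + 1))
    (θ := fun y => (t - τ (i + 1) y.2).toNNReal) (by fun_prop) hB hp
  have hpre : (fun ω => (U ω, fun j => W j ω)) ⁻¹'
      ({u : ℝ | ⌊u * ((n : ℝ) + 1)⌋₊ = i} ×ˢ C') =
        C ∩ {ω | ⌊U ω * ((n : ℝ) + 1)⌋₊ = i} := by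
    ext ω
    exact and_comm
  rw [hpre] at key
  refine key.trans ?_
  simp_rw [hfA]
  have hind : IndepFun U (fun ω j => W j ω) P :=
    hM.indep_draw.comp (φ := id) (ψ := Prod.fst) measurable_id measurable_fst
  -- The draw is independent of the waiting times, which splits off its probability `1 / (n + 1)`.
  have h1 := lintegral_mul_eq_lintegral_mul_lintegral_of_indepFun
    (μ := P) (f := fun ω => {u : ℝ | ⌊u * ((n : ℝ) + 1)⌋₊ = i}.indicator 1 (U ω))
    (g := fun ω => C'.indicator (fun w => ENNReal.ofReal (f (t - τ (i + 1) w))) fun j => W j ω)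
    ((measurable_one.indicator hD).comp hU)
    ((Measurable.indicator (by fun_prop) hC').comp (measurable_pi_lambda _ hW))
    (hind.comp (measurable_one.indicator hD) (Measurable.indicator (by fun_prop) hC'))
  have h2 : ∫⁻ ω, {u : ℝ | ⌊u * ((n : ℝ) + 1)⌋₊ = i}.indicator (1 : ℝ → ℝ≥0∞) (U ω) ∂P =
      ENNReal.ofReal (1 / ((n : ℝ) + 1)) := by
    rw [← hM.prob_draw hi, ← lintegral_indicator_one hDU]
    rfl
  rw [h2] at h1
  rw [← lintegral_indicator hC, ← lintegral_indicator (hC.inter hDU)]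
  refine Eq.trans (lintegral_congr fun ω => ?_) h1
  rw [Set.inter_comm, ← Set.indicator_indicator]
  by_cases h3 : ω ∈ U ⁻¹' {u : ℝ | ⌊u * ((n : ℝ) + 1)⌋₊ = i}
  · have h4 : {u : ℝ | ⌊u * ((n : ℝ) + 1)⌋₊ = i}.indicator (1 : ℝ → ℝ≥0∞) (U ω) = 1 :=
      Set.indicator_of_mem (by exact h3) _
    rw [Set.indicator_of_mem (by exact h3), Pi.mul_apply, h4, one_mul]
    rfl
  · have h4 : {u : ℝ | ⌊u * ((n : ℝ) + 1)⌋₊ = i}.indicator (1 : ℝ → ℝ≥0∞) (U ω) = 0 :=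
      Set.indicator_of_notMem (by exact h3) _
    rw [Set.indicator_of_notMem (by exact h3), Pi.mul_apply, h4, zero_mul]

/-- Almost surely the waits are positive and `U` lies in `[0, 1)`. The event then agrees with the
disjoint union over the index drawn, whose pieces are measurable; only null-measurability of the
event itself follows. -/
theorem IsModel.prob_drawnInLinks_of_count (hM : IsModel P ν β rate W X U) (hf : Continuous f)
    (hfA : ∀ i s, P {ω | X i (Real.toNNReal s) ω ∈ A} = ENNReal.ofReal (f s)) {t : ℝ}
    (ht : 0 ≤ t) (n : ℕ) :
    NullMeasurableSet {ω | newPageCount W t ω = n + 1 ∧ drawnInLinks W X U t ω ∈ A} P ∧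
    P {ω | newPageCount W t ω = n + 1 ∧ drawnInLinks W X U t ω ∈ A} =
      ENNReal.ofReal (1 / ((n : ℝ) + 1)) *
        ∫⁻ ω in {ω | creationTime W (n + 1) ω ≤ t ∧ t < creationTime W (n + 2) ω},
          creationSum W (fun u => f (t - u)) (n + 1) ω ∂P := by
  have hW := hM.measurable_wait
  have hfm := hf.measurable
  have hU := hM.measurable_draw
  set R : ℕ → Set Ω := fun i =>
    ({ω | creationTime W (n + 1) ω ≤ t ∧ t < creationTime W (n + 2) ω} ∩
      {ω | ⌊U ω * ((n : ℝ) + 1)⌋₊ = i}) ∩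
      {ω | X (i + 1) (t - creationTime W (i + 1) ω).toNNReal ω ∈ A} with hR
  have hRm : ∀ i, MeasurableSet (R i) := fun i => by
    have hmT := measurable_creationTime hW (i + 1)
    exact ((hM.measurableSet_between t n).inter
      ((Nat.measurable_floor.comp (hU.mul_const _)) (measurableSet_singleton i))).inter
      (measurableSet_time (Y := fun ω => (t - creationTime W (i + 1) ω).toNNReal) (by fun_prop)
        (hM.birth _).measurable (hM.birth _).rightCont A)
  have hae : ({ω | newPageCount W t ω = n + 1 ∧ drawnInLinks W X U t ω ∈ A} : Set Ω) =ᵐ[P]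
      ⋃ i ∈ Finset.range (n + 1), R i := by
    filter_upwards [hM.ae_wait_pos, hM.ae_draw_mem] with ω hω hu
    refine propext ?_
    change (newPageCount W t ω = n + 1 ∧ drawnInLinks W X U t ω ∈ A) ↔
      ω ∈ ⋃ i ∈ Finset.range (n + 1), R i
    simp only [Set.mem_iUnion, Finset.mem_range, exists_prop]
    constructor
    · rintro ⟨h1, h2⟩
      refine ⟨⌊U ω * ((n : ℝ) + 1)⌋₊, ?_, ⟨(newPageCount_eq_succ_iff hω ht n).1 h1, rfl⟩, ?_⟩
      · rw [Nat.floor_lt (mul_nonneg hu.1 (by positivity))]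
        push_cast
        nlinarith [hu.2, (Nat.cast_nonneg n : (0 : ℝ) ≤ n)]
      · rw [drawnInLinks, drawnPage, h1, add_comm 1] at h2
        push_cast at h2
        exact h2
    · rintro ⟨i, hi, ⟨h1, h2⟩, h3⟩
      have h4 := (newPageCount_eq_succ_iff hω ht n).2 h1
      refine ⟨h4, ?_⟩
      have h5 : drawnPage W U t ω = i + 1 := by
        rw [drawnPage, h4, add_comm 1]
        push_cast
        rw [show ⌊U ω * ((n : ℝ) + 1)⌋₊ = i from h2]
      rw [drawnInLinks, h5]
      exact h3
  have hUm : MeasurableSet (⋃ i ∈ Finset.range (n + 1), R i) :=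
    Finset.measurableSet_biUnion _ fun i _ => hRm i
  refine ⟨hUm.nullMeasurableSet.congr hae.symm, ?_⟩
  rw [measure_congr hae, measure_biUnion_finset _ fun i _ => hRm i]
  · simp only [creationSum]
    rw [lintegral_finsetSum _ fun i _ => by
      have hmT := measurable_creationTime hW i
      fun_prop, Finset.mul_sum]
    refine Finset.sum_nbij' (· + 1) (· - 1) (by simp)
      (fun i hi => by simp only [Finset.mem_Icc] at hi; simp; omega) (by simp)
      (fun i hi => Nat.sub_add_cancel (Finset.mem_Icc.1 hi).1) fun i hi => ?_
    exact hM.prob_draw_page hf hfA t (Nat.lt_succ_iff.1 (Finset.mem_range.1 hi))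
  · intro i _ j _ hij
    exact Set.disjoint_left.2 fun ω h1 h2 => hij (h1.1.2.symm.trans h2.1.2)

/-- The law of the number of in-links of the drawn page. -/
theorem IsModel.prob_drawnInLinks (hM : IsModel P ν β rate W X U) (hβ : 0 < β)
    (hf : Continuous f) (hf0 : ∀ s, 0 ≤ f s)
    (hfA : ∀ i s, P {ω | X i (Real.toNNReal s) ω ∈ A} = ENNReal.ofReal (f s)) {t : ℝ}
    (ht : 0 ≤ t) :
    NullMeasurableSet ({ω | 1 ≤ newPageCount W t ω} ∩ {ω | drawnInLinks W X U t ω ∈ A}) P ∧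
    P ({ω | 1 ≤ newPageCount W t ω} ∩ {ω | drawnInLinks W X U t ω ∈ A}) =
      ∫⁻ s in Set.Ioc 0 t, ENNReal.ofReal (β * Real.exp (-(β * s))) * ENNReal.ofReal (f s) := by
  have hS : {ω | 1 ≤ newPageCount W t ω} ∩ {ω | drawnInLinks W X U t ω ∈ A} =
      ⋃ n : ℕ, {ω | newPageCount W t ω = n + 1 ∧ drawnInLinks W X U t ω ∈ A} := by
    ext ω
    simp only [Set.mem_inter_iff, Set.mem_ofPred_eq, Set.mem_iUnion, exists_and_right,
      and_congr_left_iff]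
    exact fun _ => ⟨fun h => ⟨newPageCount W t ω - 1, by omega⟩, fun ⟨n, hn⟩ => by omega⟩
  have hn := hM.prob_drawnInLinks_of_count hf hfA ht
  rw [hS, ← tsum_lintegral_creationSum hβ hM.measurable_wait hM.law_wait hM.indep_wait hf hf0 ht,
    measure_iUnion₀ _ fun n => (hn n).1]
  · exact ⟨NullMeasurableSet.iUnion fun n => (hn n).1, tsum_congr fun n => (hn n).2⟩
  · intro i j hij
    refine Disjoint.aedisjoint (Set.disjoint_left.2 fun ω h1 h2 => hij ?_)
    have := h1.1.symm.trans h2.1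
    omega

/-- The case of the trivial condition `A = univ` with `f = 1`, so the normalizing constant needs no
separate computation. -/
theorem IsModel.prob_one_le_count (hM : IsModel P ν β rate W X U) (hβ : 0 < β) {t : ℝ}
    (ht : 0 ≤ t) :
    NullMeasurableSet {ω | 1 ≤ newPageCount W t ω} P ∧
    P {ω | 1 ≤ newPageCount W t ω} = ENNReal.ofReal (1 - Real.exp (-(β * t))) := by
  have h := hM.prob_drawnInLinks (A := Set.univ) (f := fun _ => 1) hβ continuous_const
    (fun _ => zero_le_one) (fun i s => by simp) ht
  have h2 : {ω | 1 ≤ newPageCount W t ω} ∩ {ω | drawnInLinks W X U t ω ∈ Set.univ} =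
      {ω | 1 ≤ newPageCount W t ω} := Set.inter_eq_left.2 fun ω _ => Set.mem_univ _
  rw [h2] at h
  refine ⟨h.1, h.2.trans ?_⟩
  rw [← integral_exp_Ioc ht, ofReal_integral_eq_lintegral_ofReal]
  · simp
  · exact (Continuous.integrableOn_Icc (by fun_prop)).mono_set Set.Ioc_subset_Icc_self
  · exact ae_of_all _ fun s => by positivity

theorem IsModel.drawMeasure_drawnInLinks (hM : IsModel P ν β rate W X U) (hβ : 0 < β)
    (hf : Continuous f) (hf0 : ∀ s, 0 ≤ f s)
    (hfA : ∀ i s, P {ω | X i (Real.toNNReal s) ω ∈ A} = ENNReal.ofReal (f s)) {t : ℝ}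
    (ht : 0 ≤ t) :
    NullMeasurableSet {ω | drawnInLinks W X U t ω ∈ A} (drawMeasure P W t) ∧
    drawMeasure P W t {ω | drawnInLinks W X U t ω ∈ A} =
      (ENNReal.ofReal (1 - Real.exp (-(β * t))))⁻¹ *
      ∫⁻ s in Set.Ioc 0 t, ENNReal.ofReal (β * Real.exp (-(β * s))) * ENNReal.ofReal (f s) := by
  have h1 := hM.prob_drawnInLinks hβ hf hf0 hfA ht
  have h2 := hM.prob_one_le_count hβ ht
  have hQ : drawMeasure P W t =
      (P {ω | 1 ≤ newPageCount W t ω})⁻¹ • P.restrict {ω | 1 ≤ newPageCount W t ω} := rfl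
  constructor
  · rw [hQ]
    refine NullMeasurableSet.mono_ac ?_ Measure.smul_absolutelyContinuous
    have h3 := h1.1.mono_ac (Measure.restrict_le_self.absolutelyContinuous :
      P.restrict {ω | 1 ≤ newPageCount W t ω} ≪ P)
    refine h3.congr ?_
    have h4 : ∀ᵐ ω ∂(P.restrict {ω | 1 ≤ newPageCount W t ω}),
        ω ∈ {ω | 1 ≤ newPageCount W t ω} := ae_restrict_mem₀ h2.1
    filter_upwards [h4] with ω hω
    exact propext ⟨fun h => h.2, fun h => ⟨hω, h⟩⟩
  · rw [hQ, Measure.smul_apply, Measure.restrict_apply₀' h2.1, Set.inter_comm, h1.2, h2.2]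
    rfl

end Draw

/-! ### Tail sums and passage to the limit -/

/-- The mean of a variable with values in `ℕ` is the sum of its tail probabilities. -/
theorem lintegral_nat_eq_tsum {Ω : Type*} [MeasurableSpace Ω] {μ : Measure Ω} {N : Ω → ℕ}
    (hN : ∀ k, NullMeasurableSet {ω | N ω ∈ Set.Ioi k} μ) :
    ∫⁻ ω, (N ω : ℝ≥0∞) ∂μ = ∑' k : ℕ, μ {ω | N ω ∈ Set.Ioi k} := by
  have h1 : ∀ ω, (N ω : ℝ≥0∞) =
      ∑' k : ℕ, {ω | N ω ∈ Set.Ioi k}.indicator (1 : Ω → ℝ≥0∞) ω := fun ω => by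
    rw [tsum_eq_sum (s := Finset.range (N ω)), Finset.sum_congr rfl (g := fun _ => 1)]
    · simp
    · intro k hk
      exact Set.indicator_of_mem (by simpa using hk) _
    · intro k hk
      exact Set.indicator_of_notMem (by simpa using hk) _
  simp_rw [h1]
  rw [lintegral_tsum fun k => show AEMeasurable ({ω | N ω ∈ Set.Ioi k}.indicator 1) μ from
    aemeasurable_one.indicator₀ (hN k)]
  exact tsum_congr fun k => lintegral_indicator_one₀ (hN k)

theorem tendsto_setLIntegral_Ioc {F : ℝ → ℝ≥0∞} (hF : Measurable F) :
    Tendsto (fun t => ∫⁻ s in Set.Ioc 0 t, F s) atTop (𝓝 (∫⁻ s in Set.Ioi 0, F s)) := by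
  have h := (aecover_Iic (μ := volume.restrict (Set.Ioi (0 : ℝ)))
    tendsto_id).lintegral_tendsto_of_countably_generated hF.aemeasurable
  refine h.congr fun t => ?_
  rw [Measure.restrict_restrict measurableSet_Iic, Set.inter_comm, Set.Ioi_inter_Iic]
  rfl

/-! ### The mean at time `t`, the limit law and the limiting mean -/

section Model

variable {Ω : Type*} [MeasurableSpace Ω] {P : Measure Ω} [IsProbabilityMeasure P]
  {ν β : ℝ} {rate : ℕ → ℝ} {W : ℕ → Ω → ℝ} {X : ℕ → ℝ≥0 → Ω → ℕ} {U : Ω → ℝ}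

/-- The model does not assume identically distributed in-link processes; the equations determine
their one-dimensional laws, so page `0` can stand for every page. -/
theorem IsFractionalBirthProcess.cdfProb_eq {Y Z : ℝ≥0 → Ω → ℕ}
    (hY : IsFractionalBirthProcess P ν rate Y) (hZ : IsFractionalBirthProcess P ν rate Z)
    (hν0 : 0 < ν) (hν1 : ν < 1) (hrate : ∀ r, 1 ≤ r → 0 ≤ rate r)
    (hdist : Set.InjOn rate (Set.Ici 1)) (k : ℕ) (t : ℝ) :
    cdfProb P Y k t = cdfProb P Z k t := by
  rcases lt_or_ge 0 t with ht | ht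
  · rw [hY.cdfProb_eq_sum hν0 hν1 hrate hdist k ht, hZ.cdfProb_eq_sum hν0 hν1 hrate hdist k ht]
  · rcases k with _ | k
    · rw [hY.cdfProb_zero, hZ.cdfProb_zero]
    · rw [hY.cdfProb_of_nonpos (by omega) ht, hZ.cdfProb_of_nonpos (by omega) ht]

theorem IsFractionalBirthProcess.stateProb_eq {Y Z : ℝ≥0 → Ω → ℕ}
    (hY : IsFractionalBirthProcess P ν rate Y) (hZ : IsFractionalBirthProcess P ν rate Z)
    (hν0 : 0 < ν) (hν1 : ν < 1) (hrate : ∀ r, 1 ≤ r → 0 ≤ rate r)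
    (hdist : Set.InjOn rate (Set.Ici 1)) (k : ℕ) (t : ℝ) :
    stateProb P Y k t = stateProb P Z k t := by
  rcases k with _ | k
  · rw [hY.stateProb_zero, hZ.stateProb_zero]
  · have h1 := cdfProb_succ (P := P) hY.measurable k t
    have h2 := cdfProb_succ (P := P) hZ.measurable k t
    rw [hY.cdfProb_eq hZ hν0 hν1 hrate hdist, hY.cdfProb_eq hZ hν0 hν1 hrate hdist] at h1
    linarith

theorem prob_mem_Ioi {Y : ℝ≥0 → Ω → ℕ} (hY : ∀ t, Measurable (Y t)) (k : ℕ) (s : ℝ) :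
    P {ω | Y s.toNNReal ω ∈ Set.Ioi k} = ENNReal.ofReal (1 - cdfProb P Y k s) := by
  have hm : MeasurableSet {ω | Y s.toNNReal ω ≤ k} := hY _ measurableSet_Iic
  have h : {ω | Y s.toNNReal ω ∈ Set.Ioi k} = {ω | Y s.toNNReal ω ≤ k}ᶜ := by
    ext ω
    simp
  rw [h, cdfProb, ← probReal_compl_eq_one_sub hm, ofReal_measureReal]

theorem prob_mem_singleton (Y : ℝ≥0 → Ω → ℕ) (n : ℕ) (s : ℝ) :
    P {ω | Y s.toNNReal ω ∈ ({n} : Set ℕ)} = ENNReal.ofReal (stateProb P Y n s) := by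
  rw [stateProb, ofReal_measureReal]
  rfl

/-- The law of a birth process at an independent exponential time. -/
noncomputable def limitLaw (P : Measure Ω) (β : ℝ) (Y : ℝ≥0 → Ω → ℕ) : Measure ℕ :=
  ((volume.restrict (Set.Ioi 0)).withDensity
    fun s => ENNReal.ofReal (β * Real.exp (-(β * s)))).bind fun s => P.map (Y s.toNNReal)

theorem IsFractionalBirthProcess.limitLaw_apply {Y : ℝ≥0 → Ω → ℕ}
    (hY : IsFractionalBirthProcess P ν rate Y) (A : Set ℕ) :
    limitLaw P β Y A = ∫⁻ s in Set.Ioi 0, ENNReal.ofReal (β * Real.exp (-(β * s))) *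
      P {ω | Y s.toNNReal ω ∈ A} := by
  -- The mixture requires a measurable family of laws; each probability is a countable sum of
  -- continuous functions of `s`.
  have hsm : ∀ B : Set ℕ, Measurable fun s : ℝ => P.map (Y s.toNNReal) B := fun B => by
    have h1 : ∀ s : ℝ, P.map (Y s.toNNReal) B =
        ∑' n, B.indicator (fun n => ENNReal.ofReal (stateProb P Y n s)) n := fun s => by
      rw [← Measure.tsum_indicator_apply_singleton _ B MeasurableSet.of_discrete]
      congr 1
      ext n
      congr 1
      ext n
      rw [Measure.map_apply (hY.measurable _) (measurableSet_singleton n),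
        ← prob_mem_singleton]
      rfl
    simp_rw [h1]
    refine Measurable.tsum fun n => ?_
    have hs := (hY.continuous_stateProb n).measurable
    by_cases hn : n ∈ B
    · simp only [Set.indicator_of_mem hn]
      fun_prop
    · simp only [Set.indicator_of_notMem hn]
      fun_prop
  have hmap : ∀ s : ℝ, P.map (Y s.toNNReal) A = P {ω | Y s.toNNReal ω ∈ A} := fun s =>
    Measure.map_apply (hY.measurable _) MeasurableSet.of_discrete
  rw [limitLaw, Measure.bind_apply MeasurableSet.of_discrete
    (Measure.measurable_of_measurable_coe _ fun B _ => hsm B).aemeasurable,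
    lintegral_withDensity_eq_lintegral_mul _ (by fun_prop) (hsm A)]
  simp_rw [Pi.mul_apply, hmap]

theorem IsFractionalBirthProcess.isProbabilityMeasure_limitLaw {Y : ℝ≥0 → Ω → ℕ}
    (hY : IsFractionalBirthProcess P ν rate Y) (hβ : 0 < β) :
    IsProbabilityMeasure (limitLaw P β Y) := by
  refine ⟨?_⟩
  rw [hY.limitLaw_apply]
  simpa using lintegral_exp_Ioi hβ

theorem IsFractionalBirthProcess.lintegral_limitLaw {Y : ℝ≥0 → Ω → ℕ}
    (hY : IsFractionalBirthProcess P ν rate Y) (hν0 : 0 < ν) (hν1 : ν < 1) (hβ : 0 < β)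
    (hrate : ∀ r, 1 ≤ r → 0 ≤ rate r) (hdist : Set.InjOn rate (Set.Ici 1)) :
    ∫⁻ n, (n : ℝ≥0∞) ∂(limitLaw P β Y) =
      1 + ∑' k : ℕ, ENNReal.ofReal (limitTerm ν β rate (k + 1)) := by
  have h1 := lintegral_nat_eq_tsum (μ := limitLaw P β Y) (N := id)
    fun k => MeasurableSet.of_discrete.nullMeasurableSet
  simp only [id_eq] at h1
  rw [h1]
  have h : ∀ k : ℕ, limitLaw P β Y {n | n ∈ Set.Ioi k} =
      ENNReal.ofReal (limitTerm ν β rate k) := fun k => by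
    rw [hY.limitLaw_apply, ← hY.setLIntegral_Ioi_one_sub_cdfProb hν0 hν1 hβ hrate hdist k]
    simp_rw [← prob_mem_Ioi hY.measurable]
    rfl
  simp_rw [h]
  rw [tsum_eq_zero_add' ENNReal.summable, limitTerm_zero, ENNReal.ofReal_one]

theorem IsModel.meanInLinks_eq_tsum (hM : IsModel P ν β rate W X U) (hν0 : 0 < ν) (hν1 : ν < 1)
    (hβ : 0 < β) (hrate : ∀ r, 1 ≤ r → 0 ≤ rate r) (hdist : Set.InjOn rate (Set.Ici 1)) {t : ℝ}
    (ht : 0 ≤ t) :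
    meanInLinks P W X U t = (ENNReal.ofReal (1 - Real.exp (-(β * t))))⁻¹ *
      ∑' k : ℕ, ∫⁻ s in Set.Ioc 0 t, ENNReal.ofReal (β * Real.exp (-(β * s))) *
        ENNReal.ofReal (1 - cdfProb P (X 0) k s) := by
  have h := fun k => hM.drawMeasure_drawnInLinks (A := Set.Ioi k)
    (f := fun s => 1 - cdfProb P (X 0) k s) hβ
    (continuous_const.sub ((hM.birth 0).continuous_cdfProb k))
    (fun s => sub_nonneg.2 (cdfProb_le_one _ _))
    (fun i s => by
      rw [prob_mem_Ioi (hM.birth i).measurable,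
        (hM.birth i).cdfProb_eq (hM.birth 0) hν0 hν1 hrate hdist]) ht
  rw [meanInLinks, lintegral_nat_eq_tsum fun k => (h k).1, ← ENNReal.tsum_mul_left]
  exact tsum_congr fun k => (h k).2

theorem one_sub_exp_pos (hβ : 0 < β) {t : ℝ} (ht : 0 < t) : 0 < 1 - Real.exp (-(β * t)) := by
  rw [sub_pos, Real.exp_lt_one_iff, neg_lt_zero]
  positivity

theorem IsModel.meanInLinks_eq (hM : IsModel P ν β rate W X U) (hν0 : 0 < ν) (hν1 : ν < 1)
    (hβ : 0 < β) (hrate : ∀ r, 1 ≤ r → 0 ≤ rate r) (hdist : Set.InjOn rate (Set.Ici 1)) {t : ℝ}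
    (ht : 0 < t) :
    meanInLinks P W X U t = 1 + ∑' k : ℕ, ENNReal.ofReal (meanTerm ν β rate t (k + 1)) := by
  have hq := one_sub_exp_pos hβ ht
  -- The tail beyond `0` has index `k = 0` and supplies the leading `1` of the formula.
  have h0 : meanTerm ν β rate t 0 = 1 := by simp [meanTerm]
  rw [hM.meanInLinks_eq_tsum hν0 hν1 hβ hrate hdist ht.le, ← ENNReal.tsum_mul_left]
  have h : ∀ k : ℕ, (ENNReal.ofReal (1 - Real.exp (-(β * t))))⁻¹ *
      ∫⁻ s in Set.Ioc 0 t, ENNReal.ofReal (β * Real.exp (-(β * s))) *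
        ENNReal.ofReal (1 - cdfProb P (X 0) k s) = ENNReal.ofReal (meanTerm ν β rate t k) :=
    fun k => by
      rw [((hM.birth 0).setLIntegral_Ioc_one_sub_cdfProb hν0 hν1 hβ hrate hdist k ht).2,
        ENNReal.ofReal_mul hq.le, ← mul_assoc,
        ENNReal.inv_mul_cancel (by simpa using hq) ENNReal.ofReal_ne_top, one_mul]
  simp_rw [h]
  rw [tsum_eq_zero_add' ENNReal.summable, h0, ENNReal.ofReal_one]

theorem tendsto_inv_one_sub_exp (hβ : 0 < β) :
    Tendsto (fun t => (ENNReal.ofReal (1 - Real.exp (-(β * t))))⁻¹) atTop (𝓝 1) := by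
  have h1 : Tendsto (fun t : ℝ => 1 - Real.exp (-(β * t))) atTop (𝓝 (1 - 0)) :=
    tendsto_const_nhds.sub (Real.tendsto_exp_neg_atTop_nhds_zero.comp
      (tendsto_id.const_mul_atTop hβ))
  rw [sub_zero] at h1
  simpa using (ENNReal.tendsto_ofReal h1).inv

theorem IsModel.tendsto_meanInLinks (hM : IsModel P ν β rate W X U) (hν0 : 0 < ν) (hν1 : ν < 1)
    (hβ : 0 < β) (hrate : ∀ r, 1 ≤ r → 0 ≤ rate r) (hdist : Set.InjOn rate (Set.Ici 1)) :
    Tendsto (fun t => meanInLinks P W X U t) atTop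
      (𝓝 (1 + ∑' k : ℕ, ENNReal.ofReal (limitTerm ν β rate (k + 1)))) := by
  have hm : ∀ k : ℕ, Measurable fun s => ENNReal.ofReal (β * Real.exp (-(β * s))) *
      ENNReal.ofReal (1 - cdfProb P (X 0) k s) := fun k => by
    have := ((hM.birth 0).continuous_cdfProb k).measurable
    fun_prop
  have hsum : Measurable fun s => ∑' k : ℕ, ENNReal.ofReal (β * Real.exp (-(β * s))) *
      ENNReal.ofReal (1 - cdfProb P (X 0) k s) := Measurable.tsum hm
  have h1 := tendsto_setLIntegral_Ioc hsum
  -- The normalizing factor tends to `1`, neither `0` nor `∞`, so the product converges even when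
  -- the limiting mean is infinite.
  have h2 := ENNReal.Tendsto.mul (tendsto_inv_one_sub_exp hβ) (Or.inl one_ne_zero) h1
    (Or.inr ENNReal.one_ne_top)
  have h3 : ∫⁻ s in Set.Ioi 0, ∑' k : ℕ, ENNReal.ofReal (β * Real.exp (-(β * s))) *
      ENNReal.ofReal (1 - cdfProb P (X 0) k s) =
        1 + ∑' k : ℕ, ENNReal.ofReal (limitTerm ν β rate (k + 1)) := by
    rw [lintegral_tsum fun k => (hm k).aemeasurable]
    simp_rw [(hM.birth 0).setLIntegral_Ioi_one_sub_cdfProb hν0 hν1 hβ hrate hdist]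
    rw [tsum_eq_zero_add' ENNReal.summable, limitTerm_zero, ENNReal.ofReal_one]
  rw [h3, one_mul] at h2
  refine h2.congr' ?_
  filter_upwards [eventually_ge_atTop 0] with t ht
  rw [hM.meanInLinks_eq_tsum hν0 hν1 hβ hrate hdist ht,
    lintegral_tsum fun k => (hm k).aemeasurable]

/-- As `t → ∞` the truncated exponential age density becomes the full one, so the limit is the birth
process at an independent exponential time. Pointwise convergence of the masses to a probability on
`ℕ` is convergence in distribution. -/
theorem IsModel.tendsto_drawMeasure (hM : IsModel P ν β rate W X U) (hν0 : 0 < ν) (hν1 : ν < 1)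
    (hβ : 0 < β) (hrate : ∀ r, 1 ≤ r → 0 ≤ rate r) (hdist : Set.InjOn rate (Set.Ici 1)) (n : ℕ) :
    Tendsto (fun t => drawMeasure P W t {ω | drawnInLinks W X U t ω = n}) atTop
      (𝓝 (limitLaw P β (X 0) {n})) := by
  have hs := ((hM.birth 0).continuous_stateProb n).measurable
  have h1 := tendsto_setLIntegral_Ioc (F := fun s => ENNReal.ofReal (β * Real.exp (-(β * s))) *
    ENNReal.ofReal (stateProb P (X 0) n s)) (by fun_prop)
  have h2 := ENNReal.Tendsto.mul (tendsto_inv_one_sub_exp hβ) (Or.inl one_ne_zero) h1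
    (Or.inr ENNReal.one_ne_top)
  have h3 := (hM.birth 0).limitLaw_apply (β := β) {n}
  simp_rw [prob_mem_singleton] at h3
  rw [← h3, one_mul] at h2
  refine h2.congr' ?_
  filter_upwards [eventually_ge_atTop 0] with t ht
  exact (hM.drawMeasure_drawnInLinks (A := {n}) hβ ((hM.birth 0).continuous_stateProb n)
    (fun s => stateProb_nonneg _ _) (fun i s => by
      rw [prob_mem_singleton, (hM.birth i).stateProb_eq (hM.birth 0) hν0 hν1 hrate hdist])
      ht).2.symm

end Model

end NonlinearYule

theorem mainTheorem1 {Ω : Type*} [MeasurableSpace Ω] (P : Measure Ω) [IsProbabilityMeasure P]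
    (ν β : ℝ) (hν0 : 0 < ν) (hν1 : ν < 1) (hβ : 0 < β)
    (rate : ℕ → ℝ) (hrate : ∀ r, 1 ≤ r → 0 ≤ rate r) (hdist : Set.InjOn rate (Set.Ici 1))
    (W : ℕ → Ω → ℝ) (X : ℕ → ℝ≥0 → Ω → ℕ) (U : Ω → ℝ)
    (hmodel : NonlinearYule.IsModel P ν β rate W X U) :
    (∀ t : ℝ, 0 < t →
      (∀ m, 1 ≤ m → Summable (NonlinearYule.seriesTerm ν β t (rate m))) ∧
      (∀ k, 1 ≤ k → 0 ≤ NonlinearYule.meanTerm ν β rate t k) ∧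
      NonlinearYule.meanInLinks P W X U t =
        1 + ∑' k : ℕ, ENNReal.ofReal (NonlinearYule.meanTerm ν β rate t (k + 1))) ∧
    (∀ k, 1 ≤ k → 0 ≤ NonlinearYule.limitTerm ν β rate k) ∧
    (∃ L : Measure ℕ, IsProbabilityMeasure L ∧
      (∀ n : ℕ, Tendsto
        (fun t => NonlinearYule.drawMeasure P W t {ω | NonlinearYule.drawnInLinks W X U t ω = n})
        atTop (𝓝 (L {n}))) ∧
      ∫⁻ n, (n : ℝ≥0∞) ∂L =
        1 + ∑' k : ℕ, ENNReal.ofReal (NonlinearYule.limitTerm ν β rate (k + 1))) ∧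
    Tendsto (fun t => NonlinearYule.meanInLinks P W X U t) atTop
      (𝓝 (1 + ∑' k : ℕ, ENNReal.ofReal (NonlinearYule.limitTerm ν β rate (k + 1)))) := by
  refine ⟨fun t ht => ⟨fun m _ => (NonlinearYule.summable_and_integral_seriesTerm hν0 hβ ht (rate m)).1,
    fun k _ => ((hmodel.birth 0).setLIntegral_Ioc_one_sub_cdfProb hν0 hν1 hβ hrate hdist k ht).1,
    hmodel.meanInLinks_eq hν0 hν1 hβ hrate hdist ht⟩,
    fun k _ => NonlinearYule.limitTerm_nonneg hβ hrate hdist k,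
    ⟨NonlinearYule.limitLaw P β (X 0), (hmodel.birth 0).isProbabilityMeasure_limitLaw hβ,
      hmodel.tendsto_drawMeasure hν0 hν1 hβ hrate hdist,
      (hmodel.birth 0).lintegral_limitLaw hν0 hν1 hβ hrate hdist⟩,
    hmodel.tendsto_meanInLinks hν0 hν1 hβ hrate hdist⟩
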